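/- Let $R$ be a finite reduced root system spanning a real vector space $V_0$ (not necessarily crystallographic), with Weyl group $W$, simple roots $\Pi$, coroots $\alpha^\vee\in V_0^\vee=\mathrm{Hom}_{\mathbb R}(V_0,\mathbb R)$ and fundamental coweights $\omega_\alpha^\vee\in V_0^\vee$ ($\omega^\vee_\alpha(\beta)=\delta_{\alpha,\beta}$ for $\alpha,\beta\in\Pi$). Put $V=\mathbb C\otimes_{\mathbb R}V_0$ and $V^\vee=\mathbb C\otimes_{\mathbb R}V_0^\vee$, and let $\mathrm{Re}: V^\vee\to V_0^\vee$ be the real part. Let $k:\Pi\to\mathbb C$ satisfy $k_\alpha=k_\beta$ whenever $\alpha,\beta$ are in the same $W$-orbit. Let $\mathbb H$ be the graded Hecke algebra: the unital associative $\mathbb C$-algebra generated by $t_w$ ($w\in W$) and $v\in V$ subject to the relations of $\mathbb C[W]$ among the $t_w$, the relations of $S(V)$ among the $v$, and $t_{s_\alpha}v-s_\alpha(v)t_{s_\alpha}=k_\alpha\langle v,\alpha^\vee\rangle$ for $\alpha\in\Pi$, $v\in V$. For $J\subset\Pi$ let $W_J=\langle s_\alpha:\alpha\in J\rangle$ and let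 $\mathbb H_J\subset\mathbb H$ be the subalgebra generated by $V$ and the $t_w$, $w\in W_J$. A weight of an $\mathbb H_J$-module $U$ is a $\gamma^\vee\in V^\vee$ for which there is $0\ne u\in U$ such that, for every $v\in V$, some positive power of $v-\gamma^\vee(v)$ annihilates $u$. A Langlands datum is a pair $(J,U)$ with $J\subset\Pi$ and $U$ a finite-dimensional irreducible $\mathbb H_J$-module, all of whose weights $\gamma^\vee$ satisfy $$\mathrm{Re}\,\gamma^\vee=\sum_{\alpha\in J}a_\alpha\alpha^\vee+\sum_{\alpha\in\Pi\setminus J}b_\alpha\omega_\alpha^\vee,\qquad a_\alpha\le 0,\ b_\alpha>0.$$ The second sum is the same for all weights of $U$ and is denoted $\nu(J,U)\in V_0^\vee$. Let $I(J,U)=\mathbb H\otimes_{\mathbb H_J}U$, and let $L(J,U)$ be its unique simple quotient. For $x,y\in V_0^\vee$ write $x\le y$ if $y-x=\sum_{\alpha\in\Pi}c_\alpha\alpha^\vee$ with all $c_\alpha\ge0$. Let $(J_1,U_1)$ and $(J_2,U_2)$ be Langlands data with $\nu(J_1,U_1)\not\le\nu(J_2,U_2)$ (i.e. the two are incomparable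 or $\nu(J_2,U_2)<\nu(J_1,U_1)$). Then, for all $i\ge 0$, $$\mathrm{Ext}^i_{\mathbb H}(I(J_1,U_1),L(J_2,U_2))=0\quad\text{and}\quad \mathrm{Ext}^i_{\mathbb H}(I(J_1,U_1),I(J_2,U_2))=0,$$ where $\mathrm{Ext}_{\mathbb H}$ is taken in the category of all $\mathbb H$-modules. -/

import Mathlib

open scoped TensorProduct

universe u

namespace GradedHecke

/-- A set of simple roots `Π` of a root system: the simple roots are linearly independent and
every root is, up to sign, a combination of simple roots with non-negative real coefficients.
(For a reduced crystallographic root system the coefficients are then automatically integers.) -/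
structure SimpleSystem {ι V₀ N : Type u} [AddCommGroup V₀] [Module ℝ V₀] [AddCommGroup N]
    [Module ℝ N] (P : RootPairing ι ℝ V₀ N) where
  /-- The indices of the simple roots. -/
  support : Finset ι
  linearIndepOn_root : LinearIndepOn ℝ P.root (support : Set ι)
  root_pos_or_neg : ∀ i : ι, ∃ c : ι → ℝ, (∀ j ∈ support, 0 ≤ c j) ∧
    (P.root i = ∑ j ∈ support, c j • P.root j ∨ P.root i = -∑ j ∈ support, c j • P.root j)

section

variable {ι V₀ N : Type u} [AddCommGroup V₀] [Module ℝ V₀] [AddCommGroup N] [Module ℝ N]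
  {P : RootPairing ι ℝ V₀ N}

/-- The index type of the simple roots. -/
abbrev SimpleSystem.Idx (S : SimpleSystem P) : Type u := {i : ι // i ∈ S.support}

theorem SimpleSystem.span_eq_top [P.IsRootSystem] (S : SimpleSystem P) :
    ⊤ ≤ Submodule.span ℝ (Set.range fun α : S.Idx => P.root α.1) := by
  rw [← RootPairing.IsRootSystem.span_root_eq_top (P := P), Submodule.span_le]
  rintro _ ⟨i, rfl⟩
  have key : ∀ c : ι → ℝ, ∑ j ∈ S.support, c j • P.root j ∈
      Submodule.span ℝ (Set.range fun α : S.Idx => P.root α.1) := fun c =>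
    Submodule.sum_mem _ fun j hj =>
      Submodule.smul_mem _ _ (Submodule.subset_span ⟨⟨j, hj⟩, rfl⟩)
  obtain ⟨c, -, h | h⟩ := S.root_pos_or_neg i
  · rw [h]; exact key c
  · rw [h]; exact Submodule.neg_mem _ (key c)

/-- The simple roots form a basis of `V₀`. -/
noncomputable def SimpleSystem.basis [P.IsRootSystem] (S : SimpleSystem P) :
    Module.Basis S.Idx ℝ V₀ :=
  Module.Basis.mk (v := fun α : S.Idx => P.root α.1) S.linearIndepOn_root S.span_eq_top

/-- The fundamental coweight `ω_α^∨ ∈ V₀^∨ = Hom_ℝ(V₀, ℝ)`, given by `ω_α^∨(β) = δ_{α,β}` for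
simple roots `β`. -/
noncomputable def SimpleSystem.fundCoweight [P.IsRootSystem] (S : SimpleSystem P) (α : S.Idx) :
    Module.Dual ℝ V₀ :=
  S.basis.coord α

open Classical in
theorem SimpleSystem.fundCoweight_root [P.IsRootSystem] (S : SimpleSystem P) (α β : S.Idx) :
    S.fundCoweight α (P.root β.1) = if β = α then 1 else 0 := by
  have h : P.root β.1 = S.basis β :=
    (Module.Basis.mk_apply S.linearIndepOn_root S.span_eq_top β).symm
  rw [h, SimpleSystem.fundCoweight, Module.Basis.coord_apply, Module.Basis.repr_self,
    Finsupp.single_apply]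

/-- The simple coroot `α^∨ ∈ V₀^∨ = Hom_ℝ(V₀, ℝ)`. -/
abbrev SimpleSystem.coroot (S : SimpleSystem P) (α : S.Idx) : Module.Dual ℝ V₀ := P.coroot' α.1

/-- The simple reflection `s_α` as an element of the Weyl group `W`. -/
noncomputable abbrev SimpleSystem.s (S : SimpleSystem P) (α : S.Idx) : P.weylGroup :=
  RootPairing.weylGroup.ofIdx P α.1

/-- The dominance order on `V₀^∨`: `x ≤ y` if `y - x` is a non-negative combination of simple
coroots. -/
def SimpleSystem.DomLE (S : SimpleSystem P) (x y : Module.Dual ℝ V₀) : Prop :=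
  ∃ a : S.Idx → ℝ, (∀ α, 0 ≤ a α) ∧ y - x = ∑ α, a α • S.coroot α

/-- The parabolic subgroup `W_J` of `W` generated by the `s_α`, `α ∈ J`. -/
noncomputable def parabolicSubgroup (S : SimpleSystem P) (J : Finset S.Idx) : Subgroup P.weylGroup :=
  Subgroup.closure (S.s '' (J : Set S.Idx))

/-- A parameter function: `k_α = k_β` whenever the simple roots `α`, `β` are `W`-conjugate. -/
def IsParameter (S : SimpleSystem P) (k : S.Idx → ℂ) : Prop :=
  ∀ α β : S.Idx, (∃ w : P.weylGroup, w • P.root α.1 = P.root β.1) → k α = k β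

end

section Algebra

variable {ι V₀ N : Type u} [AddCommGroup V₀] [Module ℝ V₀] [AddCommGroup N] [Module ℝ N]
  {P : RootPairing ι ℝ V₀ N} (S : SimpleSystem P) (k : S.Idx → ℂ)

/-- The symbols `t_w` (`w ∈ W`) and `f_v` (`v ∈ V = ℂ ⊗ V₀`). -/
abbrev Gen (P : RootPairing ι ℝ V₀ N) : Type u := P.weylGroup ⊕ (ℂ ⊗[ℝ] V₀)

/-- The symbol `t_w` in the free algebra. -/
abbrev tSym (w : P.weylGroup) : FreeAlgebra ℂ (Gen P) := FreeAlgebra.ι ℂ (Sum.inl w)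

/-- The symbol `f_v` in the free algebra. -/
abbrev fSym (P : RootPairing ι ℝ V₀ N) (v : ℂ ⊗[ℝ] V₀) : FreeAlgebra ℂ (Gen P) :=
  FreeAlgebra.ι ℂ (Sum.inr v)

/-- The defining relations: `w ↦ t_w` extends to an algebra map on `ℂ[W]`, `v ↦ f_v` extends to
an algebra map on the symmetric algebra `S(V)`, and
`t_{s_α} f_v - f_{s_α(v)} t_{s_α} = k_α ⟨v, α^∨⟩` for simple `α`. -/
inductive Rel : FreeAlgebra ℂ (Gen P) → FreeAlgebra ℂ (Gen P) → Prop
  | t_one : Rel (tSym 1) 1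
  | t_mul (w w' : P.weylGroup) : Rel (tSym (w * w')) (tSym w * tSym w')
  | f_add (v v' : ℂ ⊗[ℝ] V₀) : Rel (fSym P (v + v')) (fSym P v + fSym P v')
  | f_smul (c : ℂ) (v : ℂ ⊗[ℝ] V₀) : Rel (fSym P (c • v)) (c • fSym P v)
  | f_comm (v v' : ℂ ⊗[ℝ] V₀) : Rel (fSym P v * fSym P v') (fSym P v' * fSym P v)
  | cross (α : S.Idx) (v : ℂ ⊗[ℝ] V₀) :
      Rel (tSym (S.s α) * fSym P v -
          fSym P ((P.reflection α.1).toLinearMap.baseChange ℂ v) * tSym (S.s α))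
        (algebraMap ℂ _ (k α * Module.Dual.baseChange ℂ (S.coroot α) v))

/-- The graded Hecke algebra `ℍ = ℍ(Π, k)`: the associative unital `ℂ`-algebra generated by the
symbols `t_w`, `f_v` subject to the relations above. (By the Poincaré–Birkhoff–Witt theorem, the
maps from `ℂ[W]` and `S(V)` to this algebra are injective.) -/
def Hecke : Type u := RingQuot (Rel S k)

noncomputable instance : Ring (Hecke S k) := inferInstanceAs (Ring (RingQuot (Rel S k)))

noncomputable instance : Algebra ℂ (Hecke S k) :=
  inferInstanceAs (Algebra ℂ (RingQuot (Rel S k)))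

/-- The element `t_w` of `ℍ`. -/
noncomputable def t (w : P.weylGroup) : Hecke S k := RingQuot.mkAlgHom ℂ (Rel S k) (tSym w)

/-- The element `v = f_v` of `ℍ`. -/
noncomputable def f (v : ℂ ⊗[ℝ] V₀) : Hecke S k := RingQuot.mkAlgHom ℂ (Rel S k) (fSym P v)

/-- The parabolic subalgebra `ℍ_J`, generated by all `v ∈ V` and the `t_w`, `w ∈ W_J`. -/
noncomputable def parabolic (J : Finset S.Idx) : Subalgebra ℂ (Hecke S k) :=
  Algebra.adjoin ℂ (Set.range (f S k) ∪ t S k '' (parabolicSubgroup S J : Set P.weylGroup))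

/-- The element `v = f_v` of `ℍ_J`. -/
noncomputable def fJ (J : Finset S.Idx) (v : ℂ ⊗[ℝ] V₀) : parabolic S k J :=
  ⟨f S k v, Algebra.subset_adjoin (Or.inl ⟨v, rfl⟩)⟩

end Algebra

section Modules

variable {ι V₀ N : Type u} [AddCommGroup V₀] [Module ℝ V₀] [AddCommGroup N] [Module ℝ N]
  {P : RootPairing ι ℝ V₀ N} (S : SimpleSystem P) (k : S.Idx → ℂ) (J : Finset S.Idx)

/-- The weights of an `ℍ_J`-module `U`: those `γ ∈ V^∨ = Hom_ℂ(V, ℂ)` for which there is a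
non-zero `u ∈ U` annihilated by a power of `v - γ(v)`, for every `v ∈ V`. -/
def weights (U : Type u) [AddCommGroup U] [Module (parabolic S k J) U] :
    Set (Module.Dual ℂ (ℂ ⊗[ℝ] V₀)) :=
  {γ | ∃ u : U, u ≠ 0 ∧ ∀ v : ℂ ⊗[ℝ] V₀, ∃ r : ℕ, 0 < r ∧
    (fJ S k J v - algebraMap ℂ (parabolic S k J) (γ v)) ^ r • u = 0}

/-- The real part of an element of `V^∨` with respect to the real form `V₀^∨`. -/
noncomputable def rePart (γ : Module.Dual ℂ (ℂ ⊗[ℝ] V₀)) : Module.Dual ℝ V₀ where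
  toFun v := (γ (1 ⊗ₜ[ℝ] v)).re
  map_add' v w := by rw [TensorProduct.tmul_add, map_add, Complex.add_re]
  map_smul' c v := by
    rw [TensorProduct.tmul_smul, ← algebraMap_smul ℂ c ((1 : ℂ) ⊗ₜ[ℝ] v), map_smul]
    simp

variable {S} in
open Classical in
/-- `x = ∑_{α ∈ J} a_α α^∨ + ∑_{α ∈ Π ∖ J} b_α ω_α^∨` with all `a_α ≤ 0` and all `b_α > 0`, and
`ν` is the second summand. -/
def IsTemperedForm [P.IsRootSystem] (J : Finset S.Idx) (x ν : Module.Dual ℝ V₀) : Prop :=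
  ∃ a b : S.Idx → ℝ, (∀ α ∈ J, a α ≤ 0) ∧ (∀ α ∉ J, 0 < b α) ∧
    ν = ∑ α ∈ Jᶜ, b α • S.fundCoweight α ∧ x = ∑ α ∈ J, a α • S.coroot α + ν

/-- `U` is an `ℍ_J`-tempered module. -/
def IsTempered [P.IsRootSystem] (U : Type u) [AddCommGroup U] [Module (parabolic S k J) U] :
    Prop :=
  ∀ γ ∈ weights S k J U, ∃ ν, IsTemperedForm J (rePart γ) ν

/-- `(J, U)` is a Langlands datum: `U` is a finite-dimensional irreducible `ℍ_J`-tempered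
module. -/
structure IsLanglandsDatum [P.IsRootSystem] (U : Type u) [AddCommGroup U] [Module ℂ U]
    [Module (parabolic S k J) U] : Prop where
  finite : Module.Finite ℂ U
  irreducible : IsSimpleModule (parabolic S k J) U
  tempered : IsTempered S k J U

/-- The element `ν(J, U) ∈ V₀^∨`: the second summand `∑_{α ∈ Π ∖ J} b_α ω_α^∨` of the real part of
a weight of `U`. (A finite-dimensional irreducible tempered `U` has a weight, and this summand is
the same for all its weights.) -/
noncomputable def nu [P.IsRootSystem] (U : Type u) [AddCommGroup U]
    [Module (parabolic S k J) U] : Module.Dual ℝ V₀ :=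
  Classical.epsilon fun ν => ∃ γ ∈ weights S k J U, IsTemperedForm J (rePart γ) ν

/-- The `ℍ`-submodule of `ℍ ⊗_ℂ U` of the relations `h a ⊗ u = h ⊗ a u`, `a ∈ ℍ_J`. -/
noncomputable def inducedRel (U : Type u) [AddCommGroup U] [Module ℂ U] [Module (parabolic S k J) U] :
    Submodule (Hecke S k) (Hecke S k ⊗[ℂ] U) :=
  Submodule.span (Hecke S k)
    {x | ∃ (h : Hecke S k) (a : parabolic S k J) (u : U),
      x = (h * (a : Hecke S k)) ⊗ₜ[ℂ] u - h ⊗ₜ[ℂ] (a • u)}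

/-- The induced module `I(J, U) = ℍ ⊗_{ℍ_J} U`, a left `ℍ`-module. For a Langlands datum `(J, U)`
it has exactly one maximal proper submodule `M`, and `L(J, U)` is the quotient `I(J, U) ⧸ M`. -/
abbrev Induced (U : Type u) [AddCommGroup U] [Module ℂ U] [Module (parabolic S k J) U] : Type u :=
  (Hecke S k ⊗[ℂ] U) ⧸ inducedRel S k J U

end Modules

end GradedHecke

/-!
The proof separates the two modules by a central element of `ℍ_{J₁}`. Write `ν₁`, `ν₂` for the two
vectors `ν(J, U)`. Since `ν₁` vanishes on the simple roots in `J₁` and `ν₂` is dominant, the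
relation `ν₁ ≤ ν₂` only has to be tested on the fundamental weights `ω_δ` with `δ ∉ J₁`
(`SimpleSystem.exists_fundWeight_lt`), so there is such a `δ` with `ν₂(ω_δ) < ν₁(ω_δ)`. As `ω_δ` is
orthogonal to the coroots in `J₁`, the element `f_{ω_δ}` is central in `ℍ_{J₁}`, and it acts on the
irreducible module `U₁` by a scalar `c` with real part `ν₁(ω_δ)` (`sub_smul_eq_zero`).

On the other side, the eigenvalues of `f_{ω_δ}` on `I(J₂, U₂)` have real part at most `ν₂(ω_δ)`:
modulo terms with shorter words, `f_v` acts on `t_w ⊗ U₂` through `f_{w⁻¹ v}`, where `w` may be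
taken to send the simple roots in `J₂` to positive roots. Hence `f_{ω_δ} - c` is invertible on
`I(J₂, U₂)` (`IsLanglandsDatum.sub_smul_surjective`), and on its quotients, because these are
finite-dimensional.

So there is a central `z ∈ ℍ_{J₁}` that annihilates `U₁` and is invertible on the second argument
of `Ext`. That this forces `Ext` to vanish (`subsingleton_ext`) would follow from Frobenius
reciprocity for `Ext`. Instead, it is shown by dimension shifting that for every `ℍ_{J₁}`-module
`U` the endomorphism of `Ext` induced by `z` acting on `U` is surjective (`exists_ext_eq_comp`).
The induction step needs that induction preserves the exactness of `0 → K → F → U → 0` with `F`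
free, which holds because `ℍ` is free as a right `ℍ_{J₁}`-module
(`eq_zero_of_sum_t_mul_eq_zero`). This in turn is the Poincaré–Birkhoff–Witt theorem (`exists_pbw`).
It is obtained from explicit operators on the functions `W → S(V)`; their relations reduce to the
fact that a simple reflection `s_α` permutes the positive roots other than `α`, and the operators
for `V` commute since their commutators are intertwined by `W` and vanish on functions supported
at `1`.
-/

namespace GradedHecke

/-! ### Positive roots and the invariant form -/

section Roots

variable {ι V₀ N : Type u} [AddCommGroup V₀] [Module ℝ V₀] [AddCommGroup N] [Module ℝ N]
  {P : RootPairing ι ℝ V₀ N}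

theorem weylGroup_smul_smul (w : P.weylGroup) (c : ℝ) (x : V₀) : w • (c • x) = c • (w • x) :=
  map_smul (RootPairing.weylGroupRootRep P w) c x

theorem weylGroup_ext [P.IsRootSystem] {w w' : P.weylGroup}
    (h : ∀ i, w • P.root i = w' • P.root i) : w = w' := by
  apply Subtype.ext
  apply RootPairing.Equiv.weightHom_injective P
  apply LinearEquiv.toLinearMap_injective
  refine LinearMap.ext_on_range (RootPairing.IsRootSystem.span_root_eq_top (P := P)) ?_
  exact h

theorem finite_weylGroup [Finite ι] [P.IsRootSystem] : Finite P.weylGroup := by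
  refine Finite.of_injective (fun w : P.weylGroup => P.weylGroupToPerm w) fun w w' h => ?_
  refine weylGroup_ext fun i => ?_
  rw [P.weylGroup_apply_root, P.weylGroup_apply_root]
  exact congrArg (fun σ : Equiv.Perm ι => P.root (σ i)) h

theorem ofIdx_mul_self [P.IsRootSystem] (i : ι) :
    RootPairing.weylGroup.ofIdx P i * RootPairing.weylGroup.ofIdx P i = 1 := by
  refine weylGroup_ext fun j => ?_
  rw [mul_smul, one_smul]
  exact P.reflection_same i _

theorem ofIdx_inv [P.IsRootSystem] (i : ι) :
    (RootPairing.weylGroup.ofIdx P i)⁻¹ = RootPairing.weylGroup.ofIdx P i :=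
  inv_eq_of_mul_eq_one_left (ofIdx_mul_self i)

/-- A positive definite `W`-invariant inner product, for which every coroot is a positive multiple
of the pairing with the root. -/
theorem exists_invariantForm [Finite ι] (P : RootPairing ι ℝ V₀ N) [P.IsRootSystem] :
    ∃ (B : LinearMap.BilinForm ℝ V₀) (c : ι → ℝ), (∀ i, 0 < c i) ∧
      (∀ i x, P.coroot' i x = c i * B (P.root i) x) ∧ (∀ x y, B x y = B y x) ∧
      (∀ (w : P.weylGroup) x y, B (w • x) (w • y) = B x y) ∧
      (∀ x, 0 ≤ B x x) ∧ ∀ x, B x x = 0 → x = 0 := by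
  have := Fintype.ofFinite ι
  refine ⟨P.RootForm, fun i => 2 / P.RootForm (P.root i) (P.root i), fun i => ?_, fun i x => ?_,
    fun x y => P.rootForm_symmetric.eq x y, fun w x y => ?_, P.zero_le_rootForm, fun x hx => ?_⟩
  · exact div_pos two_pos
      (P.rootForm_pos_of_ne_zero (Submodule.subset_span ⟨i, rfl⟩) (P.ne_zero i))
  · have h0 := P.rootForm_pos_of_ne_zero (Submodule.subset_span ⟨i, rfl⟩) (P.ne_zero i)
    have h := congrArg (fun y => P.toLinearMap x y) (P.rootForm_self_smul_coroot i)
    simp only [map_smul, map_nsmul, smul_eq_mul, nsmul_eq_mul,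
      P.toLinearMap_apply_apply_Polarization] at h
    have h2 : P.coroot' i x = P.toLinearMap x (P.coroot i) := rfl
    rw [h2]
    push_cast at h
    field_simp
    linarith
  · exact RootPairing.InvariantForm.apply_weylGroup_smul P (B := P.toInvariantForm) w x y
  · exact P.eq_zero_of_mem_rootSpan_of_rootForm_self_eq_zero (by simp) hx

theorem coroot'_smul [Finite ι] [P.IsRootSystem] {w : P.weylGroup} {i j : ι}
    (h : w • P.root i = P.root j) (x : V₀) : P.coroot' j (w • x) = P.coroot' i x := by
  obtain ⟨B, c, -, hc, -, hw, -, h0⟩ := exists_invariantForm P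
  have h1 : c i * B (P.root i) (P.root i) = 2 := by rw [← hc]; simp
  have h2 : c j * B (P.root j) (P.root j) = 2 := by rw [← hc]; simp
  rw [← h, hw] at h2
  have h3 : c j = c i :=
    mul_right_cancel₀ (fun h' => P.ne_zero i (h0 _ h')) (h2.trans h1.symm)
  rw [hc, hc, ← h, hw, h3]

theorem ofIdx_smul (i : ι) (x : V₀) :
    RootPairing.weylGroup.ofIdx P i • x = x - P.coroot' i x • P.root i :=
  P.reflection_apply i x

theorem mul_ofIdx_of_smul_root [Finite ι] [P.IsRootSystem] {w : P.weylGroup} {i j : ι}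
    (h : w • P.root i = P.root j) :
    w * RootPairing.weylGroup.ofIdx P i = RootPairing.weylGroup.ofIdx P j * w := by
  refine weylGroup_ext fun l => ?_
  rw [mul_smul, mul_smul, ofIdx_smul, ofIdx_smul, smul_sub, weylGroup_smul_smul, h, coroot'_smul h]

end Roots

namespace SimpleSystem

variable {ι V₀ N : Type u} [AddCommGroup V₀] [Module ℝ V₀] [AddCommGroup N] [Module ℝ N]
  {P : RootPairing ι ℝ V₀ N} (S : SimpleSystem P)

/-- The product of a word in the simple reflections. -/
noncomputable def wordProd (l : List S.Idx) : P.weylGroup := (l.map S.s).prod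

@[simp] theorem wordProd_nil : S.wordProd [] = 1 := rfl

@[simp] theorem wordProd_cons (α : S.Idx) (l : List S.Idx) :
    S.wordProd (α :: l) = S.s α * S.wordProd l := by simp [wordProd]

theorem wordProd_append (l l' : List S.Idx) :
    S.wordProd (l ++ l') = S.wordProd l * S.wordProd l' := by simp [wordProd]

variable [P.IsRootSystem]

/-- A vector is non-negative if its coordinates in the basis of simple roots are. The positive
roots are the non-negative ones. -/
def IsNonneg (x : V₀) : Prop := ∀ α, 0 ≤ S.basis.repr x α

theorem basis_apply (α : S.Idx) : S.basis α = P.root α.1 :=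
  Module.Basis.mk_apply S.linearIndepOn_root S.span_eq_top α

theorem sum_repr_smul_root (x : V₀) : ∑ α, S.basis.repr x α • P.root α.1 = x := by
  simpa only [basis_apply] using S.basis.sum_repr x

theorem repr_root (α : S.Idx) : S.basis.repr (P.root α.1) = Finsupp.single α 1 := by
  rw [← S.basis_apply, Module.Basis.repr_self]

theorem isNonneg_root (α : S.Idx) : S.IsNonneg (P.root α.1) := by
  classical
  intro β
  rw [repr_root, Finsupp.single_apply]
  split_ifs <;> simp

variable {S} in
theorem IsNonneg.eq_zero {x : V₀} (h : S.IsNonneg x) (h' : S.IsNonneg (-x)) : x = 0 := by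
  refine S.basis.ext_elem fun α => ?_
  have h1 := h α
  have h2 := h' α
  simp only [map_neg, Finsupp.neg_apply, map_zero, Finsupp.zero_apply] at *
  linarith

theorem isNonneg_or_neg (i : ι) : S.IsNonneg (P.root i) ∨ S.IsNonneg (-P.root i) := by
  have key : ∀ c : ι → ℝ, (∀ j ∈ S.support, 0 ≤ c j) →
      S.IsNonneg (∑ j ∈ S.support, c j • P.root j) := by
    intro c hc α
    rw [← Finset.sum_coe_sort, map_sum, Finsupp.finsetSum_apply]
    refine Finset.sum_nonneg fun β _ => ?_
    rw [map_smul, Finsupp.smul_apply, smul_eq_mul]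
    exact mul_nonneg (hc _ β.2) (S.isNonneg_root β α)
  obtain ⟨c, hc, h | h⟩ := S.root_pos_or_neg i
  · exact Or.inl (h ▸ key c hc)
  · right
    rw [h, neg_neg]
    exact key c hc

theorem isNonneg_or_neg_smul (w : P.weylGroup) (i : ι) :
    S.IsNonneg (w • P.root i) ∨ S.IsNonneg (-(w • P.root i)) := by
  rw [P.weylGroup_apply_root]
  exact S.isNonneg_or_neg _

theorem repr_s_smul {α β : S.Idx} (h : β ≠ α) (x : V₀) :
    S.basis.repr (S.s α • x) β = S.basis.repr x β := by
  classical
  rw [ofIdx_smul, map_sub, map_smul, repr_root]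
  simp [h.symm]

/-- The reflection in a simple root `α` permutes the positive roots other than `α`. -/
theorem eq_of_isNonneg_of_not_isNonneg [P.IsReduced] {α : S.Idx} {i : ι}
    (h : S.IsNonneg (P.root i)) (h' : ¬ S.IsNonneg (S.s α • P.root i)) : i = α.1 := by
  have h'' := (S.isNonneg_or_neg_smul (S.s α) i).resolve_left h'
  have h0 : ∀ β ≠ α, S.basis.repr (P.root i) β = 0 := fun β hβ => by
    have h1 := h'' β
    rw [map_neg, Finsupp.neg_apply, S.repr_s_smul hβ] at h1
    exact le_antisymm (by linarith) (h β)
  have h1 : P.root i = S.basis.repr (P.root i) α • P.root α.1 := by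
    conv_lhs => rw [← S.sum_repr_smul_root (P.root i)]
    exact Finset.sum_eq_single α (fun β _ hβ => by rw [h0 β hβ, zero_smul]) (by simp)
  have h2 : ¬ LinearIndependent ℝ ![P.root i, P.root α.1] := by
    rw [LinearIndependent.pair_iff]
    intro hl
    have := hl 1 (-S.basis.repr (P.root i) α) (by
      rw [one_smul, neg_smul]
      exact add_neg_eq_zero.2 h1)
    simp at this
  rcases RootPairing.IsReduced.eq_or_eq_neg (P := P) i α.1 h2 with h3 | h3
  · exact P.root.injective h3
  · refine absurd ((S.isNonneg_root α).eq_zero ?_) (P.ne_zero _)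
    rwa [← h3]

/-- Distinct simple roots form an obtuse angle. -/
theorem coroot'_root_nonpos {α β : S.Idx} (h : α ≠ β) : P.coroot' α.1 (P.root β.1) ≤ 0 := by
  classical
  have h1 : S.basis.repr (S.s α • P.root β.1) β = 1 := by
    rw [S.repr_s_smul h.symm, repr_root, Finsupp.single_eq_same]
  rcases S.isNonneg_or_neg_smul (S.s α) β.1 with h2 | h2
  · have := h2 α
    rw [ofIdx_smul, map_sub, map_smul, repr_root, repr_root] at this
    simpa [h.symm] using this
  · have := h2 β
    rw [map_neg, Finsupp.neg_apply, h1] at this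
    norm_num at this

theorem exists_coroot'_pos [Finite ι] {x : V₀} (h : S.IsNonneg x) (hx : x ≠ 0) :
    ∃ α : S.Idx, 0 < P.coroot' α.1 x := by
  obtain ⟨B, c, hc, hcB, -, -, hB, h0⟩ := exists_invariantForm P
  by_contra! hα
  refine hx (h0 x (le_antisymm ?_ (hB x)))
  have h1 : B x x = ∑ α, S.basis.repr x α * B (P.root α.1) x := by
    conv_lhs => rw [← S.sum_repr_smul_root x, LinearMap.map_sum₂, S.sum_repr_smul_root x]
    exact Finset.sum_congr rfl fun α _ => by rw [map_smul, LinearMap.smul_apply, smul_eq_mul]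
  rw [h1]
  refine Finset.sum_nonpos fun α _ => mul_nonpos_of_nonneg_of_nonpos (h α) ?_
  have := hα α
  rw [hcB] at this
  exact nonpos_of_mul_nonpos_right this (hc _)

/-- Every positive root is conjugate to a simple one under the group generated by the simple
reflections. -/
theorem exists_smul_root_eq_simple [Finite ι] [P.IsReduced] {i : ι} (h : S.IsNonneg (P.root i)) :
    ∃ w ∈ Subgroup.closure (Set.range S.s), ∃ α : S.Idx, w • P.root i = P.root α.1 := by
  classical
  -- A root of least height in the orbit, among the positive ones, is simple.
  let T : Set ι := {j | S.IsNonneg (P.root j) ∧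
    ∃ w ∈ Subgroup.closure (Set.range S.s), w • P.root i = P.root j}
  let ht : V₀ →ₗ[ℝ] ℝ := ∑ α, S.basis.coord α
  obtain ⟨j, ⟨hj, w, hw, hwj⟩, hmin⟩ :=
    Set.exists_min_image T (fun j => ht (P.root j)) (Set.toFinite T)
      ⟨i, h, 1, one_mem _, one_smul _ _⟩
  obtain ⟨α, hα⟩ := S.exists_coroot'_pos hj (P.ne_zero j)
  by_cases hn : S.IsNonneg (S.s α • P.root j)
  · have h1 := hmin (P.weylGroupToPerm (S.s α) j) ⟨by rwa [← P.weylGroup_apply_root],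
      S.s α * w, mul_mem (Subgroup.subset_closure ⟨α, rfl⟩) hw, by
        rw [mul_smul, hwj, P.weylGroup_apply_root]⟩
    rw [← P.weylGroup_apply_root, ofIdx_smul, map_sub, map_smul] at h1
    have h2 : ht (P.root α.1) = 1 := by
      simp [ht, LinearMap.sum_apply, repr_root, Finsupp.single_apply]
    rw [h2, smul_eq_mul] at h1
    linarith
  · exact ⟨w, hw, α, by rw [hwj, S.eq_of_isNonneg_of_not_isNonneg hj hn]⟩

theorem closure_range_s [Finite ι] [P.IsReduced] : Subgroup.closure (Set.range S.s) = ⊤ := by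
  have hpos : ∀ i, S.IsNonneg (P.root i) →
      RootPairing.weylGroup.ofIdx P i ∈ Subgroup.closure (Set.range S.s) := by
    intro i hi
    obtain ⟨w, hw, α, h⟩ := S.exists_smul_root_eq_simple hi
    rw [← inv_mul_cancel_left w (RootPairing.weylGroup.ofIdx P i), mul_ofIdx_of_smul_root h]
    exact mul_mem (inv_mem hw) (mul_mem (Subgroup.subset_closure ⟨α, rfl⟩) hw)
  have hall : ∀ i, RootPairing.weylGroup.ofIdx P i ∈ Subgroup.closure (Set.range S.s) := by
    intro i
    rcases S.isNonneg_or_neg i with hi | hi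
    · exact hpos i hi
    · have h1 : P.root (P.reflectionPerm i i) = -P.root i := by
        rw [P.root_reflectionPerm, P.reflection_apply_self]
      have h2 : RootPairing.weylGroup.ofIdx P i • P.root i = P.root (P.reflectionPerm i i) := by
        rw [P.root_reflectionPerm]; rfl
      have h3 := mul_ofIdx_of_smul_root h2
      rw [mul_right_cancel h3]
      exact hpos _ (by rwa [h1])
  rw [eq_top_iff]
  rintro ⟨w, hw⟩ -
  induction hw using RootPairing.weylGroup.induction with
  | mem i => exact hall i
  | one => exact one_mem _
  | mul x y hx hy h1 h2 => exact mul_mem h1 h2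

theorem exists_wordProd [Finite ι] [P.IsReduced] (w : P.weylGroup) :
    ∃ l, S.wordProd l = w := by
  have hw : w ∈ Subgroup.closure (Set.range S.s) := by rw [closure_range_s]; trivial
  induction hw using Subgroup.closure_induction_left with
  | one => exact ⟨[], rfl⟩
  | mul_left x hx y _ ih =>
    obtain ⟨α, rfl⟩ := hx
    obtain ⟨l, rfl⟩ := ih
    exact ⟨α :: l, S.wordProd_cons α l⟩
  | inv_mul_cancel x hx y _ ih =>
    obtain ⟨α, rfl⟩ := hx
    obtain ⟨l, rfl⟩ := ih
    exact ⟨α :: l, by rw [S.wordProd_cons, ofIdx_inv]⟩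

/-- The exchange condition: if `w` is the product of a word and `w α` is negative, then `w s_α` is
the product of the word with one letter removed. -/
theorem exists_wordProd_mul_s [Finite ι] [P.IsReduced] (l : List S.Idx) {α : S.Idx}
    (h : ¬ S.IsNonneg (S.wordProd l • P.root α.1)) :
    ∃ l' : List S.Idx, l'.length + 1 = l.length ∧ S.wordProd l' = S.wordProd l * S.s α := by
  induction l with
  | nil => exact absurd (by simpa using S.isNonneg_root α) h
  | cons β l ih =>
    by_cases hl : S.IsNonneg (S.wordProd l • P.root α.1)
    · refine ⟨l, rfl, ?_⟩
      rw [wordProd_cons, mul_smul] at h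
      rw [P.weylGroup_apply_root] at hl h
      have h1 := S.eq_of_isNonneg_of_not_isNonneg hl h
      have h2 : S.wordProd l • P.root α.1 = P.root β.1 := by rw [P.weylGroup_apply_root, h1]
      rw [wordProd_cons, mul_assoc, mul_ofIdx_of_smul_root h2, ← mul_assoc, ofIdx_mul_self, one_mul]
    · obtain ⟨l', h1, h2⟩ := ih hl
      exact ⟨β :: l', by simp [h1], by rw [wordProd_cons, wordProd_cons, h2, mul_assoc]⟩

/-! ### Dominant vectors and fundamental weights -/

/-- A vector of `V₀` is dominant if its pairings with the simple coroots are non-negative. -/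
def IsDominant (x : V₀) : Prop := ∀ α : S.Idx, 0 ≤ P.coroot' α.1 x

variable {S} in
theorem IsDominant.coroot'_nonneg [Finite ι] {x : V₀} (hx : S.IsDominant x) {i : ι}
    (hi : S.IsNonneg (P.root i)) : 0 ≤ P.coroot' i x := by
  obtain ⟨B, c, hc, hcB, -, -, hB, h0⟩ := exists_invariantForm P
  rw [hcB]
  refine mul_nonneg (hc i).le ?_
  rw [← S.sum_repr_smul_root (P.root i), LinearMap.map_sum₂]
  refine Finset.sum_nonneg fun α _ => ?_
  rw [map_smul, LinearMap.smul_apply, smul_eq_mul]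
  refine mul_nonneg (hi α) ?_
  have := hx α
  rw [hcB] at this
  exact nonneg_of_mul_nonneg_right this (hc _)

/-- For a dominant vector `x` and a dominant functional `ν`, the value of `ν` on the orbit of `x`
is largest at `x`. -/
theorem apply_wordProd_inv_smul_le [Finite ι] [P.IsReduced] {x : V₀} (hx : S.IsDominant x)
    {ν : Module.Dual ℝ V₀} (hν : ∀ α : S.Idx, 0 ≤ ν (P.root α.1)) (l : List S.Idx) :
    ν ((S.wordProd l)⁻¹ • x) ≤ ν x := by
  induction hn : l.length using Nat.strong_induction_on generalizing l with
  | _ n ih =>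
    rcases List.eq_nil_or_concat l with rfl | ⟨l', α, rfl⟩
    · simp
    rw [List.concat_eq_append] at hn ⊢
    · rw [List.length_append, List.length_singleton] at hn
      by_cases h : S.IsNonneg (S.wordProd l' • P.root α.1)
      · refine le_trans ?_ (ih _ (by omega) l' rfl)
        have h1 : P.coroot' α.1 ((S.wordProd l')⁻¹ • x) =
            P.coroot' (P.weylGroupToPerm (S.wordProd l') α.1) x := by
          rw [← coroot'_smul (P.weylGroup_apply_root (S.wordProd l') α.1), smul_inv_smul]
        rw [P.weylGroup_apply_root] at h
        have h2 := hx.coroot'_nonneg h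
        rw [wordProd_append, wordProd_cons, wordProd_nil, mul_one, mul_inv_rev, mul_smul, ofIdx_inv,
          ofIdx_smul, h1, map_sub, map_smul ν, smul_eq_mul]
        have := mul_nonneg h2 (hν α)
        linarith
      · obtain ⟨l'', h1, h2⟩ := S.exists_wordProd_mul_s l' h
        have := ih _ (by omega) l'' rfl
        rwa [wordProd_append, wordProd_cons, wordProd_nil, mul_one, ← h2]

theorem eq_zero_of_coroot' [Finite ι] {x : V₀} (h : ∀ α : S.Idx, P.coroot' α.1 x = 0) : x = 0 := by
  obtain ⟨B, c, hc, hcB, -, -, hB, h0⟩ := exists_invariantForm P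
  have h1 : ∀ α : S.Idx, B (P.root α.1) x = 0 := fun α => by
    have := h α
    rw [hcB] at this
    exact (mul_eq_zero.1 this).resolve_left (hc _).ne'
  apply h0
  conv_lhs => rw [← S.sum_repr_smul_root x, LinearMap.map_sum₂, S.sum_repr_smul_root x]
  exact Finset.sum_eq_zero fun α _ => by rw [map_smul, LinearMap.smul_apply, h1, smul_zero]

theorem exists_corootEquiv [Finite ι] :
    ∃ e : V₀ ≃ₗ[ℝ] (S.Idx → ℝ), ∀ x α, e x α = P.coroot' α.1 x := by
  have := Module.Finite.of_basis S.basis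
  refine ⟨LinearEquiv.ofInjectiveOfFinrankEq (LinearMap.pi fun α : S.Idx => P.coroot' α.1) ?_ ?_,
    fun x α => rfl⟩
  · rw [← LinearMap.ker_eq_bot, LinearMap.ker_eq_bot']
    exact fun x hx => S.eq_zero_of_coroot' fun α => congrFun hx α
  · rw [Module.finrank_eq_card_basis S.basis, Module.finrank_fintype_fun_eq_card]

/-- The linear isomorphism given by the pairings with the simple coroots. -/
noncomputable def corootEquiv [Finite ι] : V₀ ≃ₗ[ℝ] (S.Idx → ℝ) := S.exists_corootEquiv.choose

theorem corootEquiv_apply [Finite ι] (x : V₀) (α : S.Idx) : S.corootEquiv x α = P.coroot' α.1 x :=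
  S.exists_corootEquiv.choose_spec x α

open Classical in
/-- The fundamental weights: the basis of `V₀` dual to the simple coroots. -/
noncomputable def fundWeight [Finite ι] (δ : S.Idx) : V₀ := S.corootEquiv.symm (Pi.single δ 1)

open Classical in
theorem coroot'_fundWeight [Finite ι] (α δ : S.Idx) :
    P.coroot' α.1 (S.fundWeight δ) = if α = δ then 1 else 0 := by
  rw [← corootEquiv_apply, fundWeight, LinearEquiv.apply_symm_apply, Pi.single_apply]

theorem isDominant_fundWeight [Finite ι] (δ : S.Idx) : S.IsDominant (S.fundWeight δ) := by
  classical
  intro α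
  rw [coroot'_fundWeight]
  split_ifs <;> simp

theorem sum_apply_fundWeight_smul_coroot [Finite ι] (D : Module.Dual ℝ V₀) :
    ∑ α, D (S.fundWeight α) • S.coroot α = D := by
  classical
  ext x
  have h : x = ∑ α, P.coroot' α.1 x • S.fundWeight α := by
    apply S.corootEquiv.injective
    ext β
    rw [corootEquiv_apply, corootEquiv_apply, map_sum]
    simp only [map_smul, coroot'_fundWeight, smul_eq_mul, mul_ite, mul_one, mul_zero]
    simp
  conv_rhs => rw [h, map_sum]
  rw [LinearMap.sum_apply]
  refine Finset.sum_congr rfl fun α _ => ?_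
  rw [map_smul, LinearMap.smul_apply, smul_eq_mul, smul_eq_mul, mul_comm]

/-- A combination of simple coroots that is non-negative on the simple roots in `J` and whose
coefficients outside `J` are non-negative has non-negative coefficients. -/
theorem coeff_nonneg [Finite ι] (J : Finset S.Idx) (d : S.Idx → ℝ)
    (hd : ∀ α ∉ J, 0 ≤ d α)
    (hD : ∀ β ∈ J, 0 ≤ ∑ α, d α * P.coroot' α.1 (P.root β.1)) (α : S.Idx) : 0 ≤ d α := by
  obtain ⟨B, c, hc, hcB, hsymm, -, hB, h0⟩ := exists_invariantForm P
  -- The negative part of the combination, moved to `V₀`.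
  let y : V₀ := ∑ β : S.Idx, (max (-d β) 0 * c β.1) • P.root β.1
  have hy : ∀ z, B z y = ∑ β, max (-d β) 0 * P.coroot' β.1 z := fun z => by
    rw [hsymm, LinearMap.map_sum₂]
    exact Finset.sum_congr rfl fun β _ => by
      rw [map_smul, LinearMap.smul_apply, smul_eq_mul, hcB, mul_assoc]
  have h1 : 0 ≤ ∑ β, max (-d β) 0 * c β.1 * ∑ α, d α * P.coroot' α.1 (P.root β.1) := by
    refine Finset.sum_nonneg fun β _ => ?_
    by_cases hβ : β ∈ J
    · exact mul_nonneg (mul_nonneg (le_max_right _ _) (hc _).le) (hD β hβ)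
    · rw [max_eq_right (by linarith [hd β hβ])]
      simp
  have h2 : ∀ β α : S.Idx, max (-d β) 0 * (d α * P.coroot' α.1 (P.root β.1)) ≤
      -(max (-d β) 0 * (max (-d α) 0 * P.coroot' α.1 (P.root β.1))) := by
    intro β α
    rcases eq_or_ne α β with rfl | hαβ
    · rcases le_total (d α) 0 with h | h
      · rw [max_eq_left (by linarith)]
        linarith
      · rw [max_eq_right (by linarith)]
        simp
    · have h3 := S.coroot'_root_nonpos hαβ
      have h4 : -max (-d α) 0 ≤ d α := by linarith [le_max_left (-d α) 0]
      have h5 := mul_le_mul_of_nonneg_left (mul_le_mul_of_nonpos_right h4 h3)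
        (le_max_right (-d β) 0)
      linarith
  have h3 : B y y ≤ 0 := by
    have h4 : B y y = ∑ β, max (-d β) 0 * c β.1 *
        ∑ α, max (-d α) 0 * P.coroot' α.1 (P.root β.1) := by
      conv_lhs => rw [LinearMap.map_sum₂]
      exact Finset.sum_congr rfl fun β _ => by
        rw [map_smul, LinearMap.smul_apply, smul_eq_mul, hy]
    rw [h4, ← neg_nonneg]
    refine h1.trans ?_
    rw [← Finset.sum_neg_distrib]
    refine Finset.sum_le_sum fun β _ => ?_
    rw [Finset.mul_sum, Finset.mul_sum, ← Finset.sum_neg_distrib]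
    refine Finset.sum_le_sum fun α _ => ?_
    have := mul_le_mul_of_nonneg_left (h2 β α) (hc β.1).le
    linarith
  have h4 : y = 0 := h0 y (le_antisymm h3 (hB y))
  have h5 := congrArg (fun z => S.basis.repr z α) h4
  simp only [y, map_sum, map_smul, repr_root, Finsupp.finsetSum_apply, Finsupp.smul_apply,
    map_zero, Finsupp.zero_apply] at h5
  rw [Finset.sum_eq_single α (fun β _ hβ => by rw [Finsupp.single_eq_of_ne hβ.symm, smul_zero])
    (by simp), Finsupp.single_eq_same, smul_eq_mul, mul_one] at h5
  have h6 := (mul_eq_zero.1 h5).resolve_right (hc _).ne'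
  linarith [le_max_left (-d α) 0]

theorem sum_apply_fundWeight_mul [Finite ι] (D : Module.Dual ℝ V₀) (x : V₀) :
    ∑ α, D (S.fundWeight α) * P.coroot' α.1 x = D x := by
  conv_rhs => rw [← S.sum_apply_fundWeight_smul_coroot D, LinearMap.sum_apply]
  rfl

/-- If `ν₁` vanishes on the simple roots in `J` and `ν₂` is dominant, then `ν₁ ≤ ν₂` can be tested
on the fundamental weights outside `J`. -/
theorem exists_fundWeight_lt [Finite ι] {J : Finset S.Idx} {ν₁ ν₂ : Module.Dual ℝ V₀}
    (h₁ : ∀ β ∈ J, ν₁ (P.root β.1) = 0) (h₂ : ∀ β : S.Idx, 0 ≤ ν₂ (P.root β.1))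
    (h : ¬ S.DomLE ν₁ ν₂) : ∃ δ ∉ J, ν₂ (S.fundWeight δ) < ν₁ (S.fundWeight δ) := by
  by_contra! h'
  refine h ⟨fun α => (ν₂ - ν₁) (S.fundWeight α), ?_, (S.sum_apply_fundWeight_smul_coroot _).symm⟩
  refine S.coeff_nonneg J _ (fun α hα => sub_nonneg.2 (h' α hα)) fun β hβ => ?_
  rw [S.sum_apply_fundWeight_mul, LinearMap.sub_apply, h₁ β hβ, sub_zero]
  exact h₂ β

/-- A functional is determined by its values on the simple roots in `J` and the fundamental weights
outside `J`. -/
theorem dual_eq_of_eqOn [Finite ι] {J : Finset S.Idx} {ν₁ ν₂ : Module.Dual ℝ V₀}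
    (h₁ : ∀ β ∈ J, ν₁ (P.root β.1) = ν₂ (P.root β.1))
    (h₂ : ∀ δ ∉ J, ν₁ (S.fundWeight δ) = ν₂ (S.fundWeight δ)) : ν₁ = ν₂ := by
  have key : ∀ ν₁ ν₂ : Module.Dual ℝ V₀, (∀ β ∈ J, ν₁ (P.root β.1) = ν₂ (P.root β.1)) →
      (∀ δ ∉ J, ν₁ (S.fundWeight δ) = ν₂ (S.fundWeight δ)) →
      ∀ α, 0 ≤ (ν₂ - ν₁) (S.fundWeight α) := by
    intro ν₁ ν₂ h₁ h₂
    refine S.coeff_nonneg J _ (fun α hα => ?_) fun β hβ => ?_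
    · rw [LinearMap.sub_apply, h₂ α hα, sub_self]
    · rw [S.sum_apply_fundWeight_mul, LinearMap.sub_apply, h₁ β hβ, sub_self]
  rw [← sub_eq_zero, ← S.sum_apply_fundWeight_smul_coroot (ν₁ - ν₂)]
  refine Finset.sum_eq_zero fun α _ => ?_
  have h3 := key ν₁ ν₂ h₁ h₂ α
  have h4 := key ν₂ ν₁ (fun β hβ => (h₁ β hβ).symm) (fun δ hδ => (h₂ δ hδ).symm) α
  simp only [LinearMap.sub_apply] at *
  rw [show ν₁ (S.fundWeight α) - ν₂ (S.fundWeight α) = 0 by linarith, zero_smul]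

end SimpleSystem

/-! ### The Poincaré–Birkhoff–Witt theorem -/

section Hecke

variable {ι V₀ N : Type u} [AddCommGroup V₀] [Module ℝ V₀] [AddCommGroup N] [Module ℝ N]
  {P : RootPairing ι ℝ V₀ N}

/-- The action of `W` on `V = ℂ ⊗ V₀`. -/
noncomputable def weylAct (w : P.weylGroup) : ℂ ⊗[ℝ] V₀ →ₗ[ℂ] ℂ ⊗[ℝ] V₀ :=
  (P.weylGroupRootRep w).baseChange ℂ

@[simp] theorem weylAct_tmul (w : P.weylGroup) (c : ℂ) (x : V₀) :
    weylAct w (c ⊗ₜ[ℝ] x) = c ⊗ₜ[ℝ] (w • x) := rfl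

@[simp] theorem weylAct_one (v : ℂ ⊗[ℝ] V₀) : weylAct (1 : P.weylGroup) v = v := by
  rw [weylAct, map_one]
  exact LinearMap.congr_fun LinearMap.baseChange_id v

theorem weylAct_mul (w w' : P.weylGroup) (v : ℂ ⊗[ℝ] V₀) :
    weylAct (w * w') v = weylAct w (weylAct w' v) := by
  rw [weylAct, map_mul]
  exact LinearMap.congr_fun (LinearMap.baseChange_comp _ _) v

/-- The pairing of `V` with the coroots. -/
noncomputable abbrev corootC (P : RootPairing ι ℝ V₀ N) (i : ι) : Module.Dual ℂ (ℂ ⊗[ℝ] V₀) :=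
  Module.Dual.baseChange ℂ (P.coroot' i)

theorem corootC_weylAct [Finite ι] [P.IsRootSystem] {w : P.weylGroup} {i j : ι}
    (h : w • P.root i = P.root j) (v : ℂ ⊗[ℝ] V₀) :
    corootC P j (weylAct w v) = corootC P i v := by
  induction v using TensorProduct.induction_on with
  | zero => simp
  | add x y hx hy => rw [map_add, map_add, map_add, hx, hy]
  | tmul c x => rw [weylAct_tmul, Module.Dual.baseChange_apply_tmul,
      Module.Dual.baseChange_apply_tmul, coroot'_smul h]

theorem weylAct_ofIdx (i : ι) (v : ℂ ⊗[ℝ] V₀) :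
    weylAct (RootPairing.weylGroup.ofIdx P i) v =
      v - corootC P i v • ((1 : ℂ) ⊗ₜ[ℝ] P.root i) := by
  induction v using TensorProduct.induction_on with
  | zero => simp
  | add x y hx hy => rw [map_add, map_add, hx, hy, add_smul]; abel
  | tmul c x =>
    rw [weylAct_tmul, Module.Dual.baseChange_apply_tmul, ofIdx_smul, TensorProduct.tmul_sub,
      TensorProduct.tmul_smul, TensorProduct.smul_tmul', TensorProduct.smul_tmul']
    simp

variable (S : SimpleSystem P) (k : S.Idx → ℂ)

theorem t_one : t S k 1 = 1 :=
  (RingQuot.mkAlgHom_rel ℂ (Rel.t_one (S := S) (k := k))).trans (map_one _)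

theorem t_mul (w w' : P.weylGroup) : t S k (w * w') = t S k w * t S k w' :=
  (RingQuot.mkAlgHom_rel ℂ (Rel.t_mul (S := S) (k := k) w w')).trans (map_mul _ _ _)

theorem f_add (v v' : ℂ ⊗[ℝ] V₀) : f S k (v + v') = f S k v + f S k v' :=
  (RingQuot.mkAlgHom_rel ℂ (Rel.f_add (S := S) (k := k) v v')).trans (map_add _ _ _)

theorem f_smul (c : ℂ) (v : ℂ ⊗[ℝ] V₀) : f S k (c • v) = c • f S k v :=
  (RingQuot.mkAlgHom_rel ℂ (Rel.f_smul (S := S) (k := k) c v)).trans (map_smul _ _ _)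

theorem f_comm (v v' : ℂ ⊗[ℝ] V₀) : f S k v * f S k v' = f S k v' * f S k v := by
  have h := RingQuot.mkAlgHom_rel ℂ (Rel.f_comm (S := S) (k := k) v v')
  rw [map_mul, map_mul] at h
  exact h

theorem t_mul_f (α : S.Idx) (v : ℂ ⊗[ℝ] V₀) :
    t S k (S.s α) * f S k v = f S k (weylAct (S.s α) v) * t S k (S.s α) +
      algebraMap ℂ _ (k α * corootC P α.1 v) := by
  have h := RingQuot.mkAlgHom_rel ℂ (Rel.cross (S := S) (k := k) α v)
  rw [map_sub, map_mul, map_mul, AlgHom.commutes, sub_eq_iff_eq_add'] at h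
  exact h

theorem f_mul_t [P.IsRootSystem] (α : S.Idx) (v : ℂ ⊗[ℝ] V₀) :
    f S k v * t S k (S.s α) = t S k (S.s α) * f S k (weylAct (S.s α) v) -
      algebraMap ℂ _ (k α * corootC P α.1 (weylAct (S.s α) v)) := by
  rw [t_mul_f, ← weylAct_mul, ofIdx_mul_self, weylAct_one, add_sub_cancel_right]

theorem adjoin_eq_top : Algebra.adjoin ℂ (Set.range (f S k) ∪ Set.range (t S k)) = ⊤ := by
  rw [eq_top_iff]
  rintro h -
  obtain ⟨x, rfl⟩ := RingQuot.mkAlgHom_surjective ℂ (Rel S k) h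
  induction x using FreeAlgebra.induction with
  | grade0 r => rw [AlgHom.commutes]; exact Subalgebra.algebraMap_mem _ r
  | grade1 x =>
    rcases x with w | v
    · exact Algebra.subset_adjoin (Or.inr ⟨w, rfl⟩)
    · exact Algebra.subset_adjoin (Or.inl ⟨v, rfl⟩)
  | mul a b ha hb => rw [map_mul]; exact mul_mem ha hb
  | add a b ha hb => rw [map_add]; exact add_mem ha hb

/-- The map `v ↦ f_v` as a linear map. -/
noncomputable def fLinear : ℂ ⊗[ℝ] V₀ →ₗ[ℂ] Hecke S k where
  toFun := f S k
  map_add' := f_add S k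
  map_smul' := f_smul S k

theorem exists_symToHecke : ∃ φ : SymmetricAlgebra ℂ (ℂ ⊗[ℝ] V₀) →ₐ[ℂ] Hecke S k,
    ∀ v, φ (SymmetricAlgebra.ι ℂ _ v) = f S k v := by
  let A := Algebra.adjoin ℂ (Set.range (f S k))
  have : IsMulCommutative A := Algebra.isMulCommutative_adjoin ℂ (by
    rintro _ ⟨v, rfl⟩ _ ⟨v', rfl⟩
    exact f_comm S k v v')
  let _ : CommSemiring A := { A.toSemiring with mul_comm := this.is_comm.comm }
  let g : ℂ ⊗[ℝ] V₀ →ₗ[ℂ] A :=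
    (fLinear S k).codRestrict (Subalgebra.toSubmodule A) fun v => Algebra.subset_adjoin ⟨v, rfl⟩
  refine ⟨A.val.comp (SymmetricAlgebra.lift g), fun v => ?_⟩
  rw [AlgHom.comp_apply, SymmetricAlgebra.lift_ι_apply]
  rfl

/-- The algebra map `S(V) → ℍ`. -/
noncomputable def symToHecke : SymmetricAlgebra ℂ (ℂ ⊗[ℝ] V₀) →ₐ[ℂ] Hecke S k :=
  (exists_symToHecke S k).choose

@[simp] theorem symToHecke_ι (v : ℂ ⊗[ℝ] V₀) :
    symToHecke S k (SymmetricAlgebra.ι ℂ _ v) = f S k v :=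
  (exists_symToHecke S k).choose_spec v

theorem s_mem_parabolicSubgroup {J : Finset S.Idx} {α : S.Idx} (hα : α ∈ J) :
    S.s α ∈ parabolicSubgroup S J := Subgroup.subset_closure ⟨α, hα, rfl⟩

theorem parabolicSubgroup_induction [P.IsRootSystem] {J : Finset S.Idx}
    {p : P.weylGroup → Prop} (one : p 1)
    (mul : ∀ α ∈ J, ∀ w ∈ parabolicSubgroup S J, p w → p (S.s α * w)) {w : P.weylGroup}
    (hw : w ∈ parabolicSubgroup S J) : p w := by
  induction hw using Subgroup.closure_induction_left with
  | one => exact one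
  | mul_left x hx y hy ih =>
    obtain ⟨α, hα, rfl⟩ := hx
    exact mul α hα y hy ih
  | inv_mul_cancel x hx y hy ih =>
    obtain ⟨α, hα, rfl⟩ := hx
    rw [ofIdx_inv]
    exact mul α hα y hy ih

/-- The elements `t_w p` with `w ∈ W_J` and `p ∈ S(V)` span a subspace stable under multiplication
by `f_v` from the left. -/
theorem f_mul_mem_span [P.IsRootSystem] {J : Finset S.Idx} {w : P.weylGroup}
    (hw : w ∈ parabolicSubgroup S J) (v : ℂ ⊗[ℝ] V₀) (p : SymmetricAlgebra ℂ (ℂ ⊗[ℝ] V₀)) :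
    f S k v * (t S k w * symToHecke S k p) ∈ Submodule.span ℂ
      {h | ∃ w ∈ parabolicSubgroup S J, ∃ p, h = t S k w * symToHecke S k p} := by
  revert v
  refine parabolicSubgroup_induction S (p := fun w => ∀ v, f S k v * (t S k w * symToHecke S k p) ∈
    Submodule.span ℂ {h | ∃ w ∈ parabolicSubgroup S J, ∃ p, h = t S k w * symToHecke S k p})
    ?_ ?_ hw
  · intro v
    rw [t_one, one_mul, ← symToHecke_ι, ← map_mul]
    exact Submodule.subset_span ⟨1, one_mem _, _, by rw [t_one, one_mul]⟩
  · intro α hα w hw ih v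
    rw [t_mul, mul_assoc, ← mul_assoc, f_mul_t, sub_mul, mul_assoc]
    refine sub_mem ?_ ?_
    · have h := ih (weylAct (S.s α) v)
      generalize f S k (weylAct (S.s α) v) * (t S k w * symToHecke S k p) = x at h
      induction h using Submodule.span_induction with
      | mem x hx =>
        obtain ⟨w', hw', q, rfl⟩ := hx
        rw [← mul_assoc, ← t_mul]
        exact Submodule.subset_span ⟨_, mul_mem (s_mem_parabolicSubgroup S hα) hw', q, rfl⟩
      | zero => rw [mul_zero]; exact zero_mem _
      | add x y _ _ hx hy => rw [mul_add]; exact add_mem hx hy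
      | smul c x _ hx => rw [mul_smul_comm]; exact Submodule.smul_mem _ _ hx
    · rw [← Algebra.smul_def]
      exact Submodule.smul_mem _ _ (Submodule.subset_span ⟨w, hw, p, rfl⟩)

theorem mem_span_of_mem_parabolic [P.IsRootSystem] {J : Finset S.Idx} {a : Hecke S k}
    (ha : a ∈ parabolic S k J) : a ∈ Submodule.span ℂ
      {h | ∃ w ∈ parabolicSubgroup S J, ∃ p, h = t S k w * symToHecke S k p} := by
  have key : ∀ q ∈ Submodule.span ℂ
      {h | ∃ w ∈ parabolicSubgroup S J, ∃ p, h = t S k w * symToHecke S k p},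
      a * q ∈ Submodule.span ℂ
        {h | ∃ w ∈ parabolicSubgroup S J, ∃ p, h = t S k w * symToHecke S k p} := by
    induction ha using Algebra.adjoin_induction with
    | mem x hx =>
      intro q hq
      induction hq using Submodule.span_induction with
      | mem q hq =>
        obtain ⟨w, hw, p, rfl⟩ := hq
        rcases hx with ⟨v, rfl⟩ | ⟨w', hw', rfl⟩
        · exact f_mul_mem_span S k hw v p
        · rw [← mul_assoc, ← t_mul]
          exact Submodule.subset_span ⟨_, mul_mem hw' hw, p, rfl⟩
      | zero => rw [mul_zero]; exact zero_mem _
      | add y z _ _ hy hz => rw [mul_add]; exact add_mem hy hz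
      | smul c y _ hy => rw [mul_smul_comm]; exact Submodule.smul_mem _ _ hy
    | algebraMap r =>
      intro q hq
      rw [← Algebra.smul_def]
      exact Submodule.smul_mem _ _ hq
    | add x y _ _ hx hy => intro q hq; rw [add_mul]; exact add_mem (hx q hq) (hy q hq)
    | mul x y _ _ hx hy => intro q hq; rw [mul_assoc]; exact hx _ (hy q hq)
  have := key 1 (Submodule.subset_span ⟨1, one_mem _, 1, by rw [t_one, map_one, one_mul]⟩)
  rwa [mul_one] at this

theorem parabolicSubgroup_univ [Finite ι] [P.IsRootSystem] [P.IsReduced] :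
    parabolicSubgroup S Finset.univ = ⊤ := by
  rw [parabolicSubgroup, Finset.coe_univ, Set.image_univ, S.closure_range_s]

theorem exists_eq_sum [Finite ι] [P.IsRootSystem] [P.IsReduced] [Fintype P.weylGroup]
    (h : Hecke S k) : ∃ φ : P.weylGroup → SymmetricAlgebra ℂ (ℂ ⊗[ℝ] V₀),
      h = ∑ w, t S k w * symToHecke S k (φ w) := by
  classical
  have hp : h ∈ parabolic S k Finset.univ := by
    have h1 : h ∈ Algebra.adjoin ℂ (Set.range (f S k) ∪ Set.range (t S k)) := by
      rw [adjoin_eq_top]; trivial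
    refine Algebra.adjoin_mono (Set.union_subset_union_right _ ?_) h1
    rw [parabolicSubgroup_univ, Subgroup.coe_top, Set.image_univ]
  have hs := mem_span_of_mem_parabolic S k hp
  clear hp
  induction hs using Submodule.span_induction with
  | mem x hx =>
    obtain ⟨w, -, p, rfl⟩ := hx
    refine ⟨Pi.single w p, ?_⟩
    rw [Finset.sum_eq_single w (fun w' _ hw' => by rw [Pi.single_eq_of_ne hw', map_zero, mul_zero])
      (by simp), Pi.single_eq_same]
  | zero => exact ⟨0, by simp⟩
  | add x y _ _ hx hy =>
    obtain ⟨φ, rfl⟩ := hx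
    obtain ⟨ψ, rfl⟩ := hy
    exact ⟨φ + ψ, by simp [mul_add, Finset.sum_add_distrib]⟩
  | smul c x _ hx =>
    obtain ⟨φ, rfl⟩ := hx
    exact ⟨c • φ, by simp [Finset.smul_sum]⟩

/-! ### The representation of `ℍ` on functions `W → S(V)` -/

/-- The extension of the parameter function to all roots that is constant on `W`-orbits. It is
meaningful under `IsParameter`, when the value does not depend on the choice of the simple root. -/
noncomputable def rootParameter (i : ι) : ℂ :=
  Classical.epsilon fun c => ∃ (α : S.Idx) (w : P.weylGroup), w • P.root α.1 = P.root i ∧ c = k α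

variable {S k} in
theorem rootParameter_eq (hk : IsParameter S k) {α : S.Idx} {w : P.weylGroup} {i : ι}
    (h : w • P.root α.1 = P.root i) : rootParameter S k i = k α := by
  obtain ⟨β, w', h', hc⟩ := Classical.epsilon_spec (p := fun c =>
    ∃ (α : S.Idx) (w : P.weylGroup), w • P.root α.1 = P.root i ∧ c = k α) ⟨k α, α, w, h, rfl⟩
  rw [rootParameter, hc]
  exact hk β α ⟨w⁻¹ * w', by rw [mul_smul, h', ← h, inv_smul_smul]⟩

theorem rootParameter_perm (w : P.weylGroup) (i : ι) :
    rootParameter S k (P.weylGroupToPerm w i) = rootParameter S k i := by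
  unfold rootParameter
  congr 1
  ext c
  constructor
  · rintro ⟨α, w', h, hc⟩
    exact ⟨α, w⁻¹ * w', by rw [mul_smul, h, ← P.weylGroup_apply_root, inv_smul_smul], hc⟩
  · rintro ⟨α, w', h, hc⟩
    exact ⟨α, w * w', by rw [mul_smul, h, P.weylGroup_apply_root], hc⟩

open Classical in
/-- The indicator function of the non-negative vectors. -/
noncomputable def nonnegInd [P.IsRootSystem] (x : V₀) : ℂ := if S.IsNonneg x then 1 else 0

theorem nonnegInd_add_neg [P.IsRootSystem] (w : P.weylGroup) (i : ι) :
    nonnegInd S (w • P.root i) + nonnegInd S (w • -P.root i) = 1 := by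
  rw [smul_neg]
  have h0 : w • P.root i ≠ 0 := by
    rw [P.weylGroup_apply_root]; exact P.ne_zero _
  unfold nonnegInd
  by_cases h1 : S.IsNonneg (w • P.root i)
  · rw [if_pos h1, if_neg fun h2 => h0 (h1.eq_zero h2), add_zero]
  · rw [if_neg h1, if_pos ((S.isNonneg_or_neg_smul w i).resolve_left h1), zero_add]

/-- The action of `t_u` on functions `W → S(V)`; a function `φ` stands for `∑ t_w φ(w)`. -/
noncomputable def tOp (P : RootPairing ι ℝ V₀ N) (u : P.weylGroup) :
    Module.End ℂ (P.weylGroup → SymmetricAlgebra ℂ (ℂ ⊗[ℝ] V₀)) :=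
  LinearMap.funLeft ℂ _ fun w => u⁻¹ * w

theorem tOp_apply (u w : P.weylGroup) (φ : P.weylGroup → SymmetricAlgebra ℂ (ℂ ⊗[ℝ] V₀)) :
    tOp P u φ w = φ (u⁻¹ * w) := rfl

section

variable [Fintype ι] [P.IsRootSystem]

/-- The action of `f_v` on functions `W → S(V)`, from the formula
`f_v t_w = t_w f_{w⁻¹ v} + ∑ k_β ⟨v, β^∨⟩ t_{s_β w}` over the positive roots `β` with `w⁻¹ β`
negative. Since the coefficient at `w` collects the terms from `s_β w`, the sum below is over the
positive roots `β` for which `w⁻¹ β` is positive. -/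
noncomputable def fOp (v : ℂ ⊗[ℝ] V₀) :
    Module.End ℂ (P.weylGroup → SymmetricAlgebra ℂ (ℂ ⊗[ℝ] V₀)) where
  toFun φ w := SymmetricAlgebra.ι ℂ _ (weylAct w⁻¹ v) * φ w +
    ∑ i, (nonnegInd S (P.root i) * (nonnegInd S (w⁻¹ • P.root i) *
      (rootParameter S k i * corootC P i v))) • φ (RootPairing.weylGroup.ofIdx P i * w)
  map_add' φ ψ := by
    ext w
    simp only [Pi.add_apply, mul_add, smul_add, Finset.sum_add_distrib]
    abel
  map_smul' c φ := by
    ext w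
    simp only [Pi.smul_apply, RingHom.id_apply, smul_add, Finset.smul_sum, mul_smul_comm,
      smul_comm c]

theorem fOp_apply (v : ℂ ⊗[ℝ] V₀) (φ : P.weylGroup → SymmetricAlgebra ℂ (ℂ ⊗[ℝ] V₀))
    (w : P.weylGroup) : fOp S k v φ w = SymmetricAlgebra.ι ℂ _ (weylAct w⁻¹ v) * φ w +
    ∑ i, (nonnegInd S (P.root i) * (nonnegInd S (w⁻¹ • P.root i) *
      (rootParameter S k i * corootC P i v))) • φ (RootPairing.weylGroup.ofIdx P i * w) := rfl

theorem fOp_add (v v' : ℂ ⊗[ℝ] V₀) : fOp S k (v + v') = fOp S k v + fOp S k v' := by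
  ext φ w
  simp only [fOp_apply, LinearMap.add_apply, Pi.add_apply, map_add, add_mul, mul_add, add_smul,
    Finset.sum_add_distrib]
  abel

theorem fOp_smul (c : ℂ) (v : ℂ ⊗[ℝ] V₀) : fOp S k (c • v) = c • fOp S k v := by
  ext φ w
  simp only [fOp_apply, LinearMap.smul_apply, Pi.smul_apply, map_smul, smul_add, smul_mul_assoc,
    Finset.smul_sum, smul_smul, smul_eq_mul]
  congr 1
  refine Finset.sum_congr rfl fun i _ => ?_
  congr 1
  ring

variable {S k}

variable [P.IsReduced]

/-- The cross relation. After a substitution by `s_α`, the sums on the two sides differ only in the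
terms of the roots `α` and `-α`, since `s_α` permutes the other positive roots. -/
theorem tOp_mul_fOp (hk : IsParameter S k) (α : S.Idx) (v : ℂ ⊗[ℝ] V₀) :
    tOp P (S.s α) * fOp S k v = fOp S k (weylAct (S.s α) v) * tOp P (S.s α) +
      algebraMap ℂ _ (k α * corootC P α.1 v) := by
  classical
  ext φ w
  have := IsAddTorsionFree.of_isTorsionFree ℝ V₀
  have hs : (S.s α)⁻¹ = S.s α := ofIdx_inv α.1
  have hss : S.s α * S.s α = 1 := ofIdx_mul_self α.1
  set σ := P.weylGroupToPerm (S.s α) with hσ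
  have hσr : ∀ i, P.root (σ i) = S.s α • P.root i := fun i => (P.weylGroup_apply_root _ _).symm
  have hσα : P.root (σ α.1) = -P.root α.1 := by
    rw [hσr]; exact P.reflection_apply_self α.1
  have hσσ : ∀ i, σ (σ i) = i := fun i => P.root.injective (by
    rw [hσr, hσr, ← mul_smul, ofIdx_mul_self, one_smul])
  let g : ι → SymmetricAlgebra ℂ (ℂ ⊗[ℝ] V₀) := fun i =>
    (nonnegInd S (w⁻¹ • S.s α • P.root i) * (rootParameter S k i * corootC P i v)) •
      φ (RootPairing.weylGroup.ofIdx P i * (S.s α * w))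
  rw [Module.End.mul_apply, tOp_apply, fOp_apply, LinearMap.add_apply, Pi.add_apply,
    Module.End.mul_apply, fOp_apply, tOp_apply, mul_inv_rev, inv_inv, weylAct_mul, hs]
  have h1 : ∑ i, (nonnegInd S (P.root i) * (nonnegInd S ((w⁻¹ * S.s α) • P.root i) *
      (rootParameter S k i * corootC P i v))) • φ (RootPairing.weylGroup.ofIdx P i * (S.s α * w)) =
      ∑ i, nonnegInd S (P.root i) • g i := by
    refine Finset.sum_congr rfl fun i _ => ?_
    rw [mul_smul, mul_smul w⁻¹]
  have h2 : ∑ i, (nonnegInd S (P.root i) * (nonnegInd S (w⁻¹ • P.root i) *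
      (rootParameter S k i * corootC P i (weylAct (S.s α) v)))) •
        tOp P (S.s α) φ (RootPairing.weylGroup.ofIdx P i * w) =
      ∑ i, nonnegInd S (P.root (σ i)) • g i := by
    rw [← Equiv.sum_comp σ]
    refine Finset.sum_congr rfl fun i _ => ?_
    have h4 : S.s α * RootPairing.weylGroup.ofIdx P (σ i) =
        RootPairing.weylGroup.ofIdx P i * S.s α := by
      rw [← mul_ofIdx_of_smul_root (w := S.s α) (i := σ i) (j := i) (by rw [← hσr, hσσ])]
    rw [mul_smul, tOp_apply, rootParameter_perm, corootC_weylAct (P.weylGroup_apply_root _ _),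
      hs, ← mul_assoc (S.s α), h4, hσr, mul_assoc]
  have h5 : ∑ i, nonnegInd S (P.root i) • g i - ∑ i, nonnegInd S (P.root (σ i)) • g i =
      g α.1 - g (σ α.1) := by
    rw [← Finset.sum_sub_distrib]
    have hne : α.1 ≠ σ α.1 := fun h => by
      rw [← h] at hσα
      exact P.ne_zero α.1 (self_eq_neg.1 hσα)
    have hpos : nonnegInd S (P.root α.1) = 1 := if_pos (S.isNonneg_root α)
    have hneg : nonnegInd S (P.root (σ α.1)) = 0 := if_neg fun h =>
      P.ne_zero α.1 ((S.isNonneg_root α).eq_zero (by rwa [← hσα]))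
    rw [Finset.sum_eq_add α.1 (σ α.1) hne ?_ (by simp) (by simp), hσσ, hpos, hneg]
    · simp [sub_eq_add_neg]
    · rintro i - ⟨h6, h7⟩
      have h8 : S.IsNonneg (P.root i) ↔ S.IsNonneg (P.root (σ i)) := by
        constructor
        · intro h
          by_contra h'
          rw [hσr] at h'
          exact h6 (S.eq_of_isNonneg_of_not_isNonneg h h')
        · intro h
          by_contra h'
          rw [← hσσ i, hσr (σ i)] at h'
          exact h7 (by rw [← S.eq_of_isNonneg_of_not_isNonneg h h', hσσ])
      rw [nonnegInd, nonnegInd, h8, sub_self]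
  have h6 : g α.1 - g (σ α.1) = (k α * corootC P α.1 v) • φ w := by
    have h7 : RootPairing.weylGroup.ofIdx P (σ α.1) = S.s α :=
      (mul_right_cancel (mul_ofIdx_of_smul_root (hσr α.1).symm)).symm
    have h8 : corootC P (σ α.1) v = -corootC P α.1 v := by
      have h9 := corootC_weylAct (hσr α.1).symm (weylAct (S.s α) v)
      rw [← weylAct_mul, hss, weylAct_one, weylAct_ofIdx, map_sub, map_smul,
        Module.Dual.baseChange_apply_tmul, P.root_coroot'_eq_pairing, P.pairing_same] at h9
      rw [h9]
      simp
      ring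
    simp only [g]
    rw [h7, h8, rootParameter_perm, rootParameter_eq hk (one_smul _ _), ← hσr, ← hσr, hσσ, hσα,
      ← mul_assoc (S.s α), hss, one_mul, ← sub_smul]
    congr 1
    have := nonnegInd_add_neg S w⁻¹ α.1
    linear_combination (k α * corootC P α.1 v) * this
  rw [h1, h2, Module.algebraMap_end_apply, Pi.smul_apply, ← h6, ← h5]
  abel

end

theorem tOp_one : tOp P 1 = 1 := by
  ext φ w
  rw [tOp_apply, inv_one, one_mul, Module.End.one_apply]

theorem tOp_mul (u u' : P.weylGroup) : tOp P (u * u') = tOp P u * tOp P u' := by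
  ext φ w
  rw [tOp_apply, Module.End.mul_apply, tOp_apply, tOp_apply, mul_inv_rev, mul_assoc]

open Classical in
theorem tOp_single (u w : P.weylGroup) (p : SymmetricAlgebra ℂ (ℂ ⊗[ℝ] V₀)) :
    tOp P u (Pi.single w p) = Pi.single (u * w) p := by
  ext w'
  rw [tOp_apply, Pi.single_apply, Pi.single_apply]
  simp only [inv_mul_eq_iff_eq_mul]

section

variable [Fintype ι] [P.IsRootSystem]

open Classical in
theorem fOp_single_one (v : ℂ ⊗[ℝ] V₀) (p : SymmetricAlgebra ℂ (ℂ ⊗[ℝ] V₀)) :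
    fOp S k v (Pi.single 1 p) = Pi.single 1 (SymmetricAlgebra.ι ℂ _ v * p) := by
  ext w
  rw [fOp_apply, Finset.sum_eq_zero, add_zero]
  · by_cases hw : w = 1
    · subst hw
      rw [Pi.single_eq_same, Pi.single_eq_same, inv_one, weylAct_one]
    · rw [Pi.single_eq_of_ne hw, Pi.single_eq_of_ne hw, mul_zero]
  · intro i _
    by_cases hw : RootPairing.weylGroup.ofIdx P i * w = 1
    · -- Here `w` is the reflection in the root `i`, so `i` and `w⁻¹ i` have opposite signs.
      have h1 : w⁻¹ • P.root i = -P.root i := by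
        rw [inv_eq_of_mul_eq_one_left hw]
        exact P.reflection_apply_self i
      rw [h1]
      by_cases h2 : S.IsNonneg (P.root i)
      · have h3 : ¬ S.IsNonneg (-P.root i) := fun h => P.ne_zero i (h2.eq_zero h)
        simp [nonnegInd, h3]
      · simp [nonnegInd, h2]
    · rw [Pi.single_eq_of_ne hw, smul_zero]

variable {S k} [P.IsReduced]

/-- The commutators of the operators `f_v` are intertwined by the operators `t_w`. -/
theorem tOp_mul_commutator (hk : IsParameter S k) (w : P.weylGroup) (u v : ℂ ⊗[ℝ] V₀) :
    tOp P w * (fOp S k u * fOp S k v - fOp S k v * fOp S k u) =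
      (fOp S k (weylAct w u) * fOp S k (weylAct w v) -
        fOp S k (weylAct w v) * fOp S k (weylAct w u)) * tOp P w := by
  have hs : ∀ (α : S.Idx) (u v : ℂ ⊗[ℝ] V₀),
      tOp P (S.s α) * (fOp S k u * fOp S k v - fOp S k v * fOp S k u) =
      (fOp S k (weylAct (S.s α) u) * fOp S k (weylAct (S.s α) v) -
        fOp S k (weylAct (S.s α) v) * fOp S k (weylAct (S.s α) u)) * tOp P (S.s α) := by
    intro α u v
    have hprod : ∀ u v : ℂ ⊗[ℝ] V₀, tOp P (S.s α) * (fOp S k u * fOp S k v) =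
        fOp S k (weylAct (S.s α) u) * fOp S k (weylAct (S.s α) v) * tOp P (S.s α) +
          (k α * corootC P α.1 v) • fOp S k (weylAct (S.s α) u) +
          (k α * corootC P α.1 u) • fOp S k v := by
      intro u v
      rw [← mul_assoc, tOp_mul_fOp hk, add_mul, mul_assoc, tOp_mul_fOp hk, mul_add, ← mul_assoc,
        ← Algebra.smul_def, ← Algebra.commutes, ← Algebra.smul_def]
    have hlin : ∀ v : ℂ ⊗[ℝ] V₀, fOp S k (weylAct (S.s α) v) =
        fOp S k v - corootC P α.1 v • fOp S k ((1 : ℂ) ⊗ₜ[ℝ] P.root α.1) := by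
      intro v
      rw [weylAct_ofIdx, sub_eq_add_neg, fOp_add, ← neg_smul, fOp_smul]
      module
    rw [mul_sub, hprod, hprod, sub_mul]
    have h1 : (k α * corootC P α.1 v) • fOp S k (weylAct (S.s α) u) +
          (k α * corootC P α.1 u) • fOp S k v =
        (k α * corootC P α.1 u) • fOp S k (weylAct (S.s α) v) +
          (k α * corootC P α.1 v) • fOp S k u := by
      rw [hlin u, hlin v]
      module
    rw [add_assoc, h1]
    abel
  obtain ⟨l, rfl⟩ := S.exists_wordProd w
  induction l with
  | nil => simp [tOp_one]
  | cons α l ih =>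
    rw [S.wordProd_cons, tOp_mul, mul_assoc, ih, ← mul_assoc, hs, weylAct_mul, weylAct_mul,
      mul_assoc]

/-- The commutators vanish on functions supported at `1`, hence everywhere. -/
theorem fOp_comm (hk : IsParameter S k) (u v : ℂ ⊗[ℝ] V₀) :
    fOp S k u * fOp S k v = fOp S k v * fOp S k u := by
  classical
  have := finite_weylGroup (P := P)
  have := Fintype.ofFinite P.weylGroup
  refine LinearMap.ext fun φ => ?_
  rw [← sub_eq_zero, ← LinearMap.sub_apply]
  have hφ : φ = ∑ w, tOp P w (Pi.single 1 (φ w)) := by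
    simp only [tOp_single, mul_one]
    exact (Finset.univ_sum_single φ).symm
  rw [hφ, map_sum]
  refine Finset.sum_eq_zero fun w _ => ?_
  have h := tOp_mul_commutator hk w (weylAct w⁻¹ u) (weylAct w⁻¹ v)
  rw [← weylAct_mul, ← weylAct_mul, mul_inv_cancel, weylAct_one, weylAct_one] at h
  rw [← Module.End.mul_apply, ← h, Module.End.mul_apply, LinearMap.sub_apply, Module.End.mul_apply,
    Module.End.mul_apply, fOp_single_one, fOp_single_one, fOp_single_one, fOp_single_one,
    mul_left_comm, sub_self, map_zero]

theorem exists_rep (hk : IsParameter S k) :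
    ∃ R : Hecke S k →ₐ[ℂ] Module.End ℂ (P.weylGroup → SymmetricAlgebra ℂ (ℂ ⊗[ℝ] V₀)),
      (∀ w, R (t S k w) = tOp P w) ∧ ∀ v, R (f S k v) = fOp S k v := by
  let g := FreeAlgebra.lift ℂ (Sum.elim (tOp P) (fOp S k))
  have ht : ∀ w, g (tSym w) = tOp P w := fun w => by simp [g, tSym]
  have hf : ∀ v, g (fSym P v) = fOp S k v := fun v => by simp [g, fSym]
  have hrel : ∀ ⦃x y⦄, Rel S k x y → g x = g y := by
    intro x y h
    induction h with
    | t_one => rw [ht, map_one, tOp_one]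
    | t_mul w w' => rw [map_mul, ht, ht, ht, tOp_mul]
    | f_add v v' => rw [map_add, hf, hf, hf, fOp_add]
    | f_smul c v => rw [map_smul, hf, hf, fOp_smul]
    | f_comm v v' => rw [map_mul, map_mul, hf, hf, fOp_comm hk]
    | cross α v =>
      rw [map_sub, map_mul, map_mul, ht, hf, hf, AlgHom.commutes, tOp_mul_fOp hk]
      exact add_sub_cancel_left _ _
  refine ⟨RingQuot.liftAlgHom ℂ ⟨g, hrel⟩, fun w => ?_, fun v => ?_⟩
  · rw [← ht]; exact RingQuot.liftAlgHom_mkAlgHom_apply ℂ g hrel _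
  · rw [← hf]; exact RingQuot.liftAlgHom_mkAlgHom_apply ℂ g hrel _

end

variable {S k} [Finite ι] [P.IsRootSystem] [P.IsReduced]

/-- The Poincaré–Birkhoff–Witt theorem: there are coordinates of `ℍ` with respect to the `t_w`,
with values in `S(V)`. -/
theorem exists_pbw (hk : IsParameter S k) :
    ∃ Φ : Hecke S k →ₗ[ℂ] (P.weylGroup → SymmetricAlgebra ℂ (ℂ ⊗[ℝ] V₀)),
      Function.Injective Φ ∧ (∀ h u w, Φ (t S k u * h) w = Φ h (u⁻¹ * w)) ∧
      ∀ (J : Finset S.Idx), ∀ a ∈ parabolic S k J, ∀ w ∉ parabolicSubgroup S J, Φ a w = 0 := by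
  classical
  have := Fintype.ofFinite ι
  have := finite_weylGroup (P := P)
  have := Fintype.ofFinite P.weylGroup
  obtain ⟨R, ht, hf⟩ := exists_rep hk
  have hsym : ∀ p q, R (symToHecke S k p) (Pi.single 1 q) = Pi.single 1 (p * q) := by
    intro p
    induction p using SymmetricAlgebra.induction with
    | algebraMap r =>
      intro q
      rw [AlgHom.commutes, AlgHom.commutes, Module.algebraMap_end_apply, ← Algebra.smul_def]
      exact (Pi.single_smul _ _ _).symm
    | ι v => intro q; rw [symToHecke_ι, hf, fOp_single_one]
    | mul a b ha hb =>
      intro q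
      rw [map_mul, map_mul, Module.End.mul_apply, hb, ha, mul_assoc]
    | add a b ha hb =>
      intro q
      rw [map_add, map_add, LinearMap.add_apply, ha, hb, add_mul, Pi.single_add]
  let Φ : Hecke S k →ₗ[ℂ] (P.weylGroup → SymmetricAlgebra ℂ (ℂ ⊗[ℝ] V₀)) :=
    (LinearMap.applyₗ (Pi.single 1 1)).comp R.toLinearMap
  have hΦ : ∀ h, Φ h = R h (Pi.single 1 1) := fun h => rfl
  have hΦt : ∀ w p, Φ (t S k w * symToHecke S k p) = Pi.single w p := by
    intro w p
    rw [hΦ, map_mul, Module.End.mul_apply, hsym, ht, tOp_single, mul_one, mul_one]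
  refine ⟨Φ, ?_, ?_, ?_⟩
  · rw [← LinearMap.ker_eq_bot, LinearMap.ker_eq_bot']
    intro h hh
    obtain ⟨φ, rfl⟩ := exists_eq_sum S k h
    rw [map_sum] at hh
    simp only [hΦt] at hh
    rw [Finset.univ_sum_single] at hh
    simp [hh]
  · intro h u w
    rw [hΦ, map_mul, Module.End.mul_apply, ht, tOp_apply, ← hΦ]
  · intro J a ha w hw
    have h := mem_span_of_mem_parabolic S k ha
    clear ha
    induction h using Submodule.span_induction with
    | mem x hx =>
      obtain ⟨w', hw', p, rfl⟩ := hx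
      rw [hΦt, Pi.single_eq_of_ne]
      rintro rfl
      exact hw hw'
    | zero => rw [map_zero, Pi.zero_apply]
    | add x y _ _ hx hy => rw [map_add, Pi.add_apply, hx, hy, add_zero]
    | smul c x _ hx => rw [map_smul, Pi.smul_apply, hx, smul_zero]

/-- As a right `ℍ_J`-module, `ℍ` is free on the `t_w`, for `w` in a set of representatives of
`W / W_J`; this is the linear independence. -/
theorem eq_zero_of_sum_t_mul_eq_zero (hk : IsParameter S k) {J : Finset S.Idx}
    [Fintype (P.weylGroup ⧸ parabolicSubgroup S J)]
    (a : P.weylGroup ⧸ parabolicSubgroup S J → parabolic S k J)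
    (h : ∑ c, t S k c.out * (a c : Hecke S k) = 0) (c : P.weylGroup ⧸ parabolicSubgroup S J) :
    a c = 0 := by
  obtain ⟨Φ, hinj, ht, hsupp⟩ := exists_pbw hk
  apply Subtype.ext
  apply hinj
  rw [ZeroMemClass.coe_zero, map_zero]
  ext w
  by_cases hw : w ∈ parabolicSubgroup S J
  · have h1 := congrFun (congrArg Φ h) (c.out * w)
    rw [map_sum, map_zero, Finset.sum_apply, Finset.sum_eq_single c, ht, inv_mul_cancel_left] at h1
    · exact h1
    · intro c' _ hc'
      rw [ht]
      refine hsupp J _ (a c').2 _ fun h2 => hc' ?_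
      rw [← mul_assoc, Subgroup.mul_mem_cancel_right _ hw, ← QuotientGroup.eq] at h2
      simpa using h2
    · simp
  · exact hsupp J _ (a c).2 w hw

end Hecke

/-! ### Induced modules -/

namespace Induced

variable {ι V₀ N : Type u} [AddCommGroup V₀] [Module ℝ V₀] [AddCommGroup N] [Module ℝ N]
  {P : RootPairing ι ℝ V₀ N} {S : SimpleSystem P} {k : S.Idx → ℂ} {J : Finset S.Idx}

section Basic

variable {U : Type u} [AddCommGroup U] [Module ℂ U] [Module (parabolic S k J) U]

/-- The class of `h ⊗ u` in the induced module. -/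
noncomputable def mk (h : Hecke S k) (u : U) : Induced S k J U :=
  (inducedRel S k J U).mkQ (h ⊗ₜ[ℂ] u)

theorem mk_add (h : Hecke S k) (u u' : U) :
    (mk h (u + u') : Induced S k J U) = mk h u + mk h u' := by
  rw [mk, TensorProduct.tmul_add, map_add]; rfl

theorem add_mk (h h' : Hecke S k) (u : U) :
    (mk (h + h') u : Induced S k J U) = mk h u + mk h' u := by
  rw [mk, TensorProduct.add_tmul, map_add]; rfl

theorem mk_smul (c : ℂ) (h : Hecke S k) (u : U) :
    (mk h (c • u) : Induced S k J U) = c • mk h u := by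
  rw [mk, TensorProduct.tmul_smul]; rfl

theorem smul_mk (c : ℂ) (h : Hecke S k) (u : U) :
    (mk (c • h) u : Induced S k J U) = c • mk h u := by
  rw [mk, ← TensorProduct.smul_tmul']; rfl

theorem mk_zero (h : Hecke S k) : (mk h 0 : Induced S k J U) = 0 := by
  rw [mk, TensorProduct.tmul_zero, map_zero]

theorem zero_mk (u : U) : (mk 0 u : Induced S k J U) = 0 := by
  rw [mk, TensorProduct.zero_tmul, map_zero]

theorem hecke_smul_mk (h h' : Hecke S k) (u : U) :
    h • (mk h' u : Induced S k J U) = mk (h * h') u := by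
  rw [mk, ← map_smul]; rfl

theorem mk_mul (h : Hecke S k) (a : parabolic S k J) (u : U) :
    (mk (h * (a : Hecke S k)) u : Induced S k J U) = mk h (a • u) := by
  rw [mk, mk, ← sub_eq_zero, ← map_sub]
  exact (Submodule.Quotient.mk_eq_zero _).2 (Submodule.subset_span ⟨h, a, u, rfl⟩)

@[elab_as_elim]
theorem induction {p : Induced S k J U → Prop} (zero : p 0) (mk : ∀ h u, p (mk h u))
    (add : ∀ x y, p x → p y → p (x + y)) (x : Induced S k J U) : p x := by
  obtain ⟨x, rfl⟩ := (inducedRel S k J U).mkQ_surjective x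
  induction x using TensorProduct.induction_on with
  | zero => rwa [map_zero]
  | tmul h u => exact mk h u
  | add x y hx hy => rw [map_add]; exact add _ _ hx hy

theorem hom_ext {X : Type*} [AddCommGroup X] [Module (Hecke S k) X]
    {g g' : Induced S k J U →ₗ[Hecke S k] X} (h : ∀ u, g (mk 1 u) = g' (mk 1 u)) : g = g' := by
  refine LinearMap.ext fun x => ?_
  induction x using Induced.induction with
  | zero => rw [map_zero, map_zero]
  | mk a u => rw [← mul_one a, ← hecke_smul_mk, map_smul, map_smul, h]
  | add x y hx hy => rw [map_add, map_add, hx, hy]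

variable {X : Type*} [AddCommGroup X] [Module ℂ X] [Module (Hecke S k) X]
  [IsScalarTower ℂ (Hecke S k) X]

/-- Frobenius reciprocity: an `ℍ_J`-linear map `U → X` extends to the induced module. -/
noncomputable def lift (g : U →ₗ[ℂ] X)
    (hg : ∀ (a : parabolic S k J) (u : U), g (a • u) = (a : Hecke S k) • g u) :
    Induced S k J U →ₗ[Hecke S k] X :=
  (inducedRel S k J U).liftQ
    (TensorProduct.AlgebraTensorModule.lift (LinearMap.toSpanSingleton (Hecke S k) (U →ₗ[ℂ] X) g))
    (by
      rw [inducedRel, Submodule.span_le]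
      rintro _ ⟨h, a, u, rfl⟩
      rw [SetLike.mem_coe, LinearMap.mem_ker, map_sub,
        TensorProduct.AlgebraTensorModule.lift_tmul, TensorProduct.AlgebraTensorModule.lift_tmul]
      simp [hg, mul_smul])

theorem lift_mk (g : U →ₗ[ℂ] X)
    (hg : ∀ (a : parabolic S k J) (u : U), g (a • u) = (a : Hecke S k) • g u)
    (h : Hecke S k) (u : U) : lift g hg (mk h u) = h • g u := rfl

end Basic

section Map

variable {U U' : Type u}
  [AddCommGroup U] [Module ℂ U] [Module (parabolic S k J) U] [IsScalarTower ℂ (parabolic S k J) U]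
  [AddCommGroup U'] [Module ℂ U'] [Module (parabolic S k J) U']
  [IsScalarTower ℂ (parabolic S k J) U']

/-- The functoriality of the induced module. -/
noncomputable def map (g : U →ₗ[parabolic S k J] U') :
    Induced S k J U →ₗ[Hecke S k] Induced S k J U' :=
  lift { toFun := fun u => mk 1 (g u)
         map_add' := fun u u' => by rw [map_add, mk_add]
         map_smul' := fun c u => by
          rw [← algebraMap_smul (parabolic S k J) c u, map_smul, algebraMap_smul, mk_smul]; rfl }
    fun a u => by
      change (mk 1 (g (a • u)) : Induced S k J U') = (a : Hecke S k) • mk 1 (g u)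
      rw [map_smul, hecke_smul_mk, mul_one, ← mk_mul, one_mul]

@[simp] theorem map_mk (g : U →ₗ[parabolic S k J] U') (h : Hecke S k) (u : U) :
    map g (mk h u) = mk h (g u) := by
  change h • (mk 1 (g u) : Induced S k J U') = _
  rw [hecke_smul_mk, mul_one]

theorem map_surjective {g : U →ₗ[parabolic S k J] U'} (hg : Function.Surjective g) :
    Function.Surjective (map g) := by
  intro x
  induction x using Induced.induction with
  | zero => exact ⟨0, map_zero _⟩
  | mk h u =>
    obtain ⟨u, rfl⟩ := hg u
    exact ⟨mk h u, map_mk _ _ _⟩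
  | add x y hx hy =>
    obtain ⟨x, rfl⟩ := hx
    obtain ⟨y, rfl⟩ := hy
    exact ⟨x + y, map_add _ _ _⟩

/-- Induction is right exact. -/
theorem ker_map_le {g : U →ₗ[parabolic S k J] U'} (hg : Function.Surjective g) :
    LinearMap.ker (map g) ≤ LinearMap.range (map (LinearMap.ker g).subtype) := by
  set Q := LinearMap.range (map (LinearMap.ker g).subtype)
  let ψ : U → Induced S k J U ⧸ Q := fun u => Q.mkQ (mk 1 u)
  have hadd : ∀ u u', ψ (u + u') = ψ u + ψ u' := fun u u' => by
    simp only [ψ]; rw [mk_add, map_add]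
  have hsmul : ∀ (c : ℂ) u, ψ (c • u) = c • ψ u := fun c u => by
    simp only [ψ]; rw [mk_smul]; rfl
  have hact : ∀ (a : parabolic S k J) u, ψ (a • u) = (a : Hecke S k) • ψ u := fun a u => by
    simp only [ψ]; rw [← mk_mul, one_mul, ← map_smul, hecke_smul_mk, mul_one]
  have hψ : ∀ u u', g u = g u' → ψ u = ψ u' := by
    intro u u' h
    have h1 : u - u' ∈ LinearMap.ker g := by rw [LinearMap.mem_ker, map_sub, h, sub_self]
    have h2 : ψ (u - u') = 0 :=
      (Submodule.Quotient.mk_eq_zero Q).2 ⟨mk 1 ⟨u - u', h1⟩, map_mk _ _ _⟩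
    rw [← sub_add_cancel u u', hadd, h2, zero_add]
  let s := Function.surjInv hg
  have hs : ∀ u, g (s u) = u := Function.surjInv_eq hg
  let T : Induced S k J U' →ₗ[Hecke S k] Induced S k J U ⧸ Q :=
    lift { toFun := fun u => ψ (s u)
           map_add' := fun u u' => by
            rw [← hadd]
            exact hψ _ _ (by rw [map_add, hs, hs, hs])
           map_smul' := fun c u => by
            rw [RingHom.id_apply, ← hsmul]
            refine hψ _ _ ?_
            rw [← algebraMap_smul (parabolic S k J) c (s u), map_smul, algebraMap_smul, hs, hs] }
      fun a u => by
        change ψ (s (a • u)) = (a : Hecke S k) • ψ (s u)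
        rw [← hact]
        exact hψ _ _ (by rw [map_smul, hs, hs])
  have hT : T.comp (map g) = Q.mkQ := hom_ext fun u => by
    rw [LinearMap.comp_apply, map_mk]
    change (1 : Hecke S k) • ψ (s (g u)) = _
    rw [one_smul]
    exact hψ _ _ (hs _)
  intro x hx
  rw [← Submodule.Quotient.mk_eq_zero Q]
  change Q.mkQ x = 0
  rw [← hT, LinearMap.comp_apply, LinearMap.mem_ker.1 hx, map_zero]

end Map

theorem projective (A : Type u) :
    Module.Projective (Hecke S k) (Induced S k J (A →₀ parabolic S k J)) := by
  refine Module.Projective.of_lifting_property'' fun q hq => ?_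
  choose s hs using fun j : A => hq (mk 1 (Finsupp.single j 1))
  let g : (A →₀ parabolic S k J) →ₗ[ℂ] (Induced S k J (A →₀ parabolic S k J) →₀ Hecke S k) :=
    { toFun := fun x => x.sum fun j a => (a : Hecke S k) • s j
      map_add' := fun x y => Finsupp.sum_add_index' (by simp) (by simp [add_smul])
      map_smul' := fun c x => by
        rw [Finsupp.sum_smul_index' (by simp), RingHom.id_apply, Finsupp.smul_sum]
        simp }
  refine ⟨lift g fun a x => ?_, hom_ext fun x => ?_⟩
  · change ((a • x).sum fun j a => (a : Hecke S k) • s j) = _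
    rw [Finsupp.sum_smul_index' (by simp)]
    change _ = (a : Hecke S k) • (x.sum fun j a => (a : Hecke S k) • s j)
    rw [Finsupp.smul_sum]
    simp [mul_smul]
  · rw [LinearMap.comp_apply, lift_mk, one_smul, LinearMap.id_apply]
    change q (x.sum fun j a => (a : Hecke S k) • s j) = _
    induction x using Finsupp.induction_linear with
    | zero => simp [mk_zero]
    | add x y hx hy =>
      rw [Finsupp.sum_add_index' (by simp) (by simp [add_smul]), map_add, hx, hy, mk_add]
    | single j a =>
      rw [Finsupp.sum_single_index (by simp), map_smul, hs, hecke_smul_mk, mul_one,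
        ← one_mul (a : Hecke S k), mk_mul, Finsupp.smul_single, smul_eq_mul, mul_one]

section Spanning

variable {U : Type u} [AddCommGroup U] [Module ℂ U] [Module (parabolic S k J) U]

theorem symToHecke_mem (p : SymmetricAlgebra ℂ (ℂ ⊗[ℝ] V₀)) :
    symToHecke S k p ∈ parabolic S k J := by
  induction p using SymmetricAlgebra.induction with
  | algebraMap r => rw [AlgHom.commutes]; exact Subalgebra.algebraMap_mem _ r
  | ι v => rw [symToHecke_ι]; exact Algebra.subset_adjoin (Or.inl ⟨v, rfl⟩)
  | mul a b ha hb => rw [map_mul]; exact mul_mem ha hb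
  | add a b ha hb => rw [map_add]; exact add_mem ha hb

theorem t_mem {w : P.weylGroup} (hw : w ∈ parabolicSubgroup S J) : t S k w ∈ parabolic S k J :=
  Algebra.subset_adjoin (Or.inr ⟨w, hw, rfl⟩)

variable [Finite ι] [P.IsRootSystem] [P.IsReduced]

/-- The induced module is spanned by the `t_w ⊗ u`. -/
@[elab_as_elim]
theorem t_induction {p : Induced S k J U → Prop} (zero : p 0)
    (mk : ∀ w u, p (mk (t S k w) u)) (add : ∀ x y, p x → p y → p (x + y))
    (x : Induced S k J U) : p x := by
  have := finite_weylGroup (P := P)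
  have := Fintype.ofFinite P.weylGroup
  induction x using Induced.induction with
  | zero => exact zero
  | add x y hx hy => exact add x y hx hy
  | mk h u =>
    obtain ⟨φ, rfl⟩ := exists_eq_sum S k h
    induction (Finset.univ : Finset P.weylGroup) using Finset.cons_induction with
    | empty => rw [Finset.sum_empty, zero_mk]; exact zero
    | cons w s hw ih =>
      rw [Finset.sum_cons, add_mk]
      refine add _ _ ?_ ih
      have h1 : (Induced.mk (t S k w * symToHecke S k (φ w)) u : Induced S k J U) =
        Induced.mk (t S k w) ((⟨_, symToHecke_mem (φ w)⟩ : parabolic S k J) • u) :=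
          mk_mul _ ⟨_, symToHecke_mem (φ w)⟩ _
      rw [h1]
      exact mk _ _

theorem exists_eq_sum_mk [Fintype (P.weylGroup ⧸ parabolicSubgroup S J)]
    (x : Induced S k J U) :
    ∃ κ : P.weylGroup ⧸ parabolicSubgroup S J → U, x = ∑ c, mk (t S k c.out) (κ c) := by
  classical
  induction x using t_induction with
  | zero => exact ⟨0, by simp [mk_zero]⟩
  | add x y hx hy =>
    obtain ⟨κ, rfl⟩ := hx
    obtain ⟨κ', rfl⟩ := hy
    exact ⟨κ + κ', by simp [mk_add, Finset.sum_add_distrib]⟩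
  | mk w u =>
    set c : P.weylGroup ⧸ parabolicSubgroup S J := QuotientGroup.mk w with hc
    have hw : c.out⁻¹ * w ∈ parabolicSubgroup S J := by
      rw [← QuotientGroup.eq, QuotientGroup.out_eq']
    refine ⟨Pi.single c ((⟨_, t_mem hw⟩ : parabolic S k J) • u), ?_⟩
    rw [Finset.sum_eq_single c (fun c' _ hc' => by rw [Pi.single_eq_of_ne hc', mk_zero])
      (by simp), Pi.single_eq_same, ← mk_mul, ← t_mul, mul_inv_cancel_left]

theorem finite [Module.Finite ℂ U] : Module.Finite ℂ (Induced S k J U) := by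
  have := finite_weylGroup (P := P)
  have := Fintype.ofFinite (P.weylGroup ⧸ parabolicSubgroup S J)
  let T : (P.weylGroup ⧸ parabolicSubgroup S J → U) →ₗ[ℂ] Induced S k J U :=
    { toFun := fun κ => ∑ c, mk (t S k c.out) (κ c)
      map_add' := fun κ κ' => by simp [mk_add, Finset.sum_add_distrib]
      map_smul' := fun r κ => by simp [mk_smul, Finset.smul_sum] }
  refine Module.Finite.of_surjective T fun x => ?_
  obtain ⟨κ, rfl⟩ := exists_eq_sum_mk x
  exact ⟨κ, rfl⟩

end Spanning

section Free

variable [Finite ι] [P.IsRootSystem] [P.IsReduced]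

/-- Induction preserves the injectivity of the inclusion of a submodule of a free module: `ℍ` is
free as a right `ℍ_J`-module. -/
theorem map_subtype_injective (hk : IsParameter S k) {A : Type u}
    (K : Submodule (parabolic S k J) (A →₀ parabolic S k J)) :
    Function.Injective (map (S := S) (k := k) (J := J) (U := K) (U' := A →₀ parabolic S k J)
      K.subtype) := by
  have := finite_weylGroup (P := P)
  have := Fintype.ofFinite (P.weylGroup ⧸ parabolicSubgroup S J)
  rw [← LinearMap.ker_eq_bot, LinearMap.ker_eq_bot']
  intro x hx
  obtain ⟨κ, rfl⟩ := exists_eq_sum_mk x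
  refine Finset.sum_eq_zero fun c _ => ?_
  suffices h : κ c = 0 by rw [h, mk_zero]
  apply Subtype.ext
  ext1 j
  let e : Induced S k J (A →₀ parabolic S k J) →ₗ[Hecke S k] Hecke S k :=
    lift ((parabolic S k J).val.toLinearMap.comp (Finsupp.lapply j)) fun a u => rfl
  have h := congrArg e hx
  rw [map_sum, map_sum, map_zero] at h
  exact eq_zero_of_sum_t_mul_eq_zero hk (fun c => (κ c : A →₀ parabolic S k J) j)
    ((Finset.sum_congr rfl fun c _ => by rw [map_mk]; rfl).trans h) c

end Free

end Induced

/-! ### Vanishing of Ext from a central element -/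

section Ext

open CategoryTheory

variable {ι V₀ N : Type u} [AddCommGroup V₀] [Module ℝ V₀] [AddCommGroup N] [Module ℝ N]
  {P : RootPairing ι ℝ V₀ N} {S : SimpleSystem P} {k : S.Idx → ℂ} {J : Finset S.Idx}

/-- The action of a central element of `ℍ_J` on an `ℍ_J`-module. -/
noncomputable def centralEnd {z : parabolic S k J} (hz : ∀ a, z * a = a * z) (U : Type u)
    [AddCommGroup U] [Module (parabolic S k J) U] : U →ₗ[parabolic S k J] U where
  toFun u := z • u
  map_add' := smul_add z
  map_smul' a u := by rw [RingHom.id_apply, ← mul_smul, ← mul_smul, hz]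

theorem centralEnd_apply {z : parabolic S k J} (hz : ∀ a, z * a = a * z) {U : Type u}
    [AddCommGroup U] [Module (parabolic S k J) U] (u : U) : centralEnd hz U u = z • u := rfl

variable [Finite ι] [P.IsRootSystem] [P.IsReduced]

/-- If a central element `z` of `ℍ_J` acts bijectively on an `ℍ`-module `X`, then its action on `U`
induces a surjection on `Ext` from the induced module of `U` to `X`. The proof is by dimension
shifting; as the syzygies of `U` need not be annihilated by `z` when `U` is, the statement is about
all modules `U`. -/
theorem exists_ext_eq_comp (hk : IsParameter S k) {z : parabolic S k J}
    (hz : ∀ a, z * a = a * z) {X : Type u} [AddCommGroup X] [Module ℂ X] [Module (Hecke S k) X]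
    [IsScalarTower ℂ (Hecke S k) X]
    (hX : Function.Bijective fun x : X => (z : Hecke S k) • x) (n : ℕ) (U : Type u)
    [AddCommGroup U] [Module ℂ U] [Module (parabolic S k J) U]
    [IsScalarTower ℂ (parabolic S k J) U]
    (e : Abelian.Ext (ModuleCat.of (Hecke S k) (Induced S k J U))
      (ModuleCat.of (Hecke S k) X) n) :
    ∃ e' : Abelian.Ext (ModuleCat.of (Hecke S k) (Induced S k J U))
      (ModuleCat.of (Hecke S k) X) n,
      e = (Abelian.Ext.mk₀ (ModuleCat.ofHom (Induced.map (centralEnd hz U)))).comp e'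
        (zero_add n) := by
  induction n generalizing U with
  | zero =>
    obtain ⟨g, rfl⟩ := (Abelian.Ext.mk₀_bijective _ _).2 e
    let inv : X → X := (Equiv.ofBijective _ hX).symm
    have hinv : ∀ x, (z : Hecke S k) • inv x = x := (Equiv.ofBijective _ hX).apply_symm_apply
    have hinj : ∀ {x y : X}, (z : Hecke S k) • x = (z : Hecke S k) • y → x = y := fun h => hX.1 h
    let g' : U →ₗ[ℂ] X :=
      { toFun := fun u => inv (g.hom (Induced.mk 1 u))
        map_add' := fun u u' => hinj (by
          rw [smul_add, hinv, hinv, hinv, Induced.mk_add, map_add])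
        map_smul' := fun c u => hinj (by
          rw [RingHom.id_apply, smul_comm, hinv, hinv, Induced.mk_smul,
            ← algebraMap_smul (Hecke S k) c, map_smul, algebraMap_smul]) }
    have hg' : ∀ (a : parabolic S k J) (u : U), g' (a • u) = (a : Hecke S k) • g' u := by
      intro a u
      apply hinj
      change (z : Hecke S k) • inv _ = (z : Hecke S k) • (a : Hecke S k) • inv _
      rw [← mul_smul, ← Subalgebra.coe_mul, hz, Subalgebra.coe_mul, mul_smul, hinv, hinv,
        ← map_smul, Induced.hecke_smul_mk, mul_one, ← Induced.mk_mul, one_mul]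
    refine ⟨Abelian.Ext.mk₀ (ModuleCat.ofHom (Induced.lift g' hg')), ?_⟩
    rw [Abelian.Ext.mk₀_comp_mk₀, ← ModuleCat.ofHom_comp]
    congr 1
    ext1
    refine Induced.hom_ext fun u => ?_
    rw [ModuleCat.hom_ofHom, LinearMap.comp_apply, Induced.map_mk, Induced.lift_mk, one_smul,
      centralEnd_apply, hg']
    exact (hinv _).symm
  | succ n ih =>
    let F := U →₀ parabolic S k J
    let p : F →ₗ[parabolic S k J] U := Finsupp.linearCombination _ id
    have hp : Function.Surjective p := Finsupp.linearCombination_id_surjective _ _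
    let K := LinearMap.ker p
    let Sc : ShortComplex (ModuleCat.{u} (Hecke S k)) :=
      ShortComplex.mk
        (ModuleCat.ofHom (Induced.map (S := S) (k := k) (J := J) (U := K) (U' := F) K.subtype))
        (ModuleCat.ofHom (Induced.map p)) (by
          rw [← ModuleCat.ofHom_comp]
          ext1
          refine Induced.hom_ext fun u => ?_
          rw [ModuleCat.hom_ofHom, LinearMap.comp_apply, Induced.map_mk, Induced.map_mk]
          exact (congrArg _ u.2).trans (Induced.mk_zero 1))
    have hSc : Sc.ShortExact :=
      { exact := by
          rw [ShortComplex.moduleCat_exact_iff]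
          exact fun x hx => Induced.ker_map_le hp hx
        mono_f := (ModuleCat.mono_iff_injective _).2 (Induced.map_subtype_injective hk K)
        epi_g := (ModuleCat.epi_iff_surjective _).2 (Induced.map_surjective hp) }
    let τ : Sc ⟶ Sc :=
      { τ₁ := ModuleCat.ofHom (Induced.map (centralEnd hz K))
        τ₂ := ModuleCat.ofHom (Induced.map (centralEnd hz F))
        τ₃ := ModuleCat.ofHom (Induced.map (centralEnd hz U))
        comm₁₂ := by
          simp only [Sc]
          rw [← ModuleCat.ofHom_comp, ← ModuleCat.ofHom_comp]
          congr 1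
          refine Induced.hom_ext fun u => ?_
          rw [LinearMap.comp_apply, LinearMap.comp_apply]
          simp only [Induced.map_mk]
          rfl
        comm₂₃ := by
          simp only [Sc]
          rw [← ModuleCat.ofHom_comp, ← ModuleCat.ofHom_comp]
          congr 1
          refine Induced.hom_ext fun u => ?_
          rw [LinearMap.comp_apply, LinearMap.comp_apply]
          simp only [Induced.map_mk, centralEnd_apply, map_smul] }
    have hproj : Projective Sc.X₂ := by
      have := Induced.projective (S := S) (k := k) (J := J) U
      exact (IsProjective.iff_projective _).1 this
    obtain ⟨e₁, rfl⟩ := Abelian.Ext.contravariant_sequence_exact₃ hSc _ e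
      (Abelian.Ext.eq_zero_of_projective _) (add_comm 1 n)
    obtain ⟨e₂, rfl⟩ := ih K e₁
    refine ⟨hSc.extClass.comp e₂ (add_comm 1 n), ?_⟩
    have h := ShortComplex.ShortExact.extClass_naturality hSc hSc τ
    rw [← Abelian.Ext.comp_assoc _ _ _ (add_zero 1) (zero_add n) (by omega)]
    erw [h]
    rw [Abelian.Ext.comp_assoc _ _ _ (zero_add 1) (add_comm 1 n) (by omega)]

theorem subsingleton_ext (hk : IsParameter S k) {z : parabolic S k J}
    (hz : ∀ a, z * a = a * z) {X : Type u} [AddCommGroup X] [Module ℂ X] [Module (Hecke S k) X]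
    [IsScalarTower ℂ (Hecke S k) X]
    (hX : Function.Bijective fun x : X => (z : Hecke S k) • x) {U : Type u}
    [AddCommGroup U] [Module ℂ U] [Module (parabolic S k J) U]
    [IsScalarTower ℂ (parabolic S k J) U] (hU : ∀ u : U, z • u = 0) (n : ℕ) :
    Subsingleton (Abelian.Ext (ModuleCat.of (Hecke S k) (Induced S k J U))
      (ModuleCat.of (Hecke S k) X) n) := by
  refine subsingleton_of_forall_eq 0 fun e => ?_
  obtain ⟨e', rfl⟩ := exists_ext_eq_comp hk hz hX n U e
  have h : Induced.map (centralEnd hz U) = 0 := Induced.hom_ext fun u => by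
    rw [Induced.map_mk, centralEnd_apply, hU, Induced.mk_zero, LinearMap.zero_apply]
  rw [h, ModuleCat.ofHom_zero, Abelian.Ext.mk₀_zero, Abelian.Ext.zero_comp]

end Ext

/-! ### Weights of Langlands data -/

/-- Commuting endomorphisms of a finite-dimensional complex vector space have a common eigenvector
in every non-zero common invariant subspace. -/
theorem exists_common_eigenvector {A U : Type*} [AddCommGroup U] [Module ℂ U] [Module.Finite ℂ U]
    (φ : A → Module.End ℂ U) (hφ : ∀ a b u, φ a (φ b u) = φ b (φ a u)) (W₀ : Submodule ℂ U)
    (h₀ : W₀ ≠ ⊥) (hs : ∀ a, ∀ u ∈ W₀, φ a u ∈ W₀) :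
    ∃ u ∈ W₀, u ≠ 0 ∧ ∀ a, ∃ c : ℂ, φ a u = c • u := by
  -- A minimal invariant subspace consists of common eigenvectors.
  obtain ⟨W, ⟨hW, hle, hinv⟩, hmin⟩ := (wellFounded_lt (α := Submodule ℂ U)).has_min
    {W | W ≠ ⊥ ∧ W ≤ W₀ ∧ ∀ a, ∀ u ∈ W, φ a u ∈ W} ⟨W₀, h₀, le_rfl, hs⟩
  obtain ⟨u, hu, hu0⟩ := W.ne_bot_iff.1 hW
  refine ⟨u, hle hu, hu0, fun a => ?_⟩
  have : Nontrivial W := ⟨⟨⟨u, hu⟩, 0, fun h => hu0 (congrArg Subtype.val h)⟩⟩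
  obtain ⟨c, hc⟩ := Module.End.exists_eigenvalue ((φ a).restrict (hinv a))
  obtain ⟨x, hx⟩ := hc.exists_hasEigenvector
  have hx1 : φ a x = c • (x : U) := congrArg Subtype.val hx.apply_eq_smul
  have hx0 : (x : U) ≠ 0 := fun h => hx.2 (Subtype.ext h)
  let W' : Submodule ℂ U := W ⊓ LinearMap.ker (φ a - c • LinearMap.id)
  have hmem : ∀ y, y ∈ W' ↔ y ∈ W ∧ φ a y = c • y := fun y => by
    simp [W', sub_eq_zero]
  have hW' : W' = W := by
    by_contra hne
    refine hmin W' ⟨W'.ne_bot_iff.2 ⟨x, (hmem _).2 ⟨x.2, hx1⟩, hx0⟩, inf_le_left.trans hle,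
      fun b y hy => ?_⟩ (lt_of_le_of_ne inf_le_left hne)
    rw [hmem] at hy ⊢
    exact ⟨hinv b y hy.1, by rw [hφ, hy.2, map_smul]⟩
  exact ⟨c, ((hmem u).1 (by rwa [hW'])).2⟩

section Weights

variable {ι V₀ N : Type u} [AddCommGroup V₀] [Module ℝ V₀] [AddCommGroup N] [Module ℝ N]
  {P : RootPairing ι ℝ V₀ N} {S : SimpleSystem P} {k : S.Idx → ℂ} {J : Finset S.Idx}

theorem corootC_one_tmul (i : ι) (x : V₀) : corootC P i ((1 : ℂ) ⊗ₜ[ℝ] x) = P.coroot' i x := by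
  rw [Module.Dual.baseChange_apply_tmul]
  simp

theorem fJ_add (v v' : ℂ ⊗[ℝ] V₀) : fJ S k J (v + v') = fJ S k J v + fJ S k J v' :=
  Subtype.ext (f_add S k v v')

theorem fJ_smul (c : ℂ) (v : ℂ ⊗[ℝ] V₀) : fJ S k J (c • v) = c • fJ S k J v :=
  Subtype.ext (f_smul S k c v)

theorem fJ_comm (v v' : ℂ ⊗[ℝ] V₀) : fJ S k J v * fJ S k J v' = fJ S k J v' * fJ S k J v :=
  Subtype.ext (f_comm S k v v')

/-- If `v` is orthogonal to the coroots in `J`, then `f_v` is central in `ℍ_J`. -/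
theorem fJ_mul_comm [P.IsRootSystem] {v : ℂ ⊗[ℝ] V₀} (hv : ∀ α ∈ J, corootC P α.1 v = 0)
    (a : parabolic S k J) : fJ S k J v * a = a * fJ S k J v := by
  have hle : parabolic S k J ≤ Subalgebra.centralizer ℂ {f S k v} := by
    refine Algebra.adjoin_le ?_
    rintro _ (⟨v', rfl⟩ | ⟨w, hw, rfl⟩)
    · rw [SetLike.mem_coe, Subalgebra.mem_centralizer_iff]
      rintro _ rfl
      exact f_comm S k v v'
    · rw [SetLike.mem_coe, Subalgebra.mem_centralizer_iff]
      rintro _ rfl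
      refine parabolicSubgroup_induction S (p := fun w => f S k v * t S k w = t S k w * f S k v)
        ?_ ?_ hw
      · rw [t_one, mul_one, one_mul]
      · intro α hα w _ ih
        have h : weylAct (S.s α) v = v := by rw [weylAct_ofIdx, hv α hα, zero_smul, sub_zero]
        rw [t_mul, ← mul_assoc, f_mul_t, h, hv α hα, mul_zero, map_zero, sub_zero, mul_assoc, ih,
          mul_assoc]
  exact Subtype.ext ((Subalgebra.mem_centralizer_iff ℂ).1 (hle a.2) _ rfl)

theorem sub_algebraMap_comm {z : parabolic S k J} (hz : ∀ a, z * a = a * z) (c : ℂ)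
    (a : parabolic S k J) :
    (z - algebraMap ℂ _ c) * a = a * (z - algebraMap ℂ _ c) := by
  rw [sub_mul, mul_sub, hz, Algebra.commutes]

/-- Moving `f_v` past `t_w` produces `t_w f_{w⁻¹ v}` and terms with shorter words. -/
theorem f_mul_t_wordProd [P.IsRootSystem] (l : List S.Idx) (v : ℂ ⊗[ℝ] V₀) :
    f S k v * t S k (S.wordProd l) -
      t S k (S.wordProd l) * f S k (weylAct (S.wordProd l)⁻¹ v) ∈
      Submodule.span ℂ
        {h | ∃ l' : List S.Idx, l'.length < l.length ∧ h = t S k (S.wordProd l')} := by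
  induction l generalizing v with
  | nil => simp [t_one]
  | cons α l ih =>
    have h := ih (weylAct (S.s α) v)
    rw [← weylAct_mul] at h
    have h1 : (S.wordProd (α :: l))⁻¹ = (S.wordProd l)⁻¹ * S.s α := by
      rw [S.wordProd_cons, mul_inv_rev, ofIdx_inv]
    rw [h1, S.wordProd_cons, t_mul, ← mul_assoc, f_mul_t, sub_mul, sub_right_comm, mul_assoc,
      mul_assoc, ← mul_sub, ← Algebra.smul_def]
    refine sub_mem ?_ (Submodule.smul_mem _ _ (Submodule.subset_span ⟨l, by simp, rfl⟩))
    generalize f S k _ * t S k (S.wordProd l) - _ = x at h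
    induction h using Submodule.span_induction with
    | mem x hx =>
      obtain ⟨l', hl', rfl⟩ := hx
      rw [← t_mul, ← S.wordProd_cons]
      exact Submodule.subset_span ⟨α :: l', by simpa using hl', rfl⟩
    | zero => rw [mul_zero]; exact zero_mem _
    | add x y _ _ hx hy => rw [mul_add]; exact add_mem hx hy
    | smul c x _ hx => rw [mul_smul_comm]; exact Submodule.smul_mem _ _ hx

/-- On an irreducible module, a central `f_v` acts by the value of any weight. -/
theorem sub_smul_eq_zero [P.IsRootSystem] {U : Type u} [AddCommGroup U]
    [Module (parabolic S k J) U] (hU : IsSimpleModule (parabolic S k J) U)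
    {v : ℂ ⊗[ℝ] V₀} (hv : ∀ α ∈ J, corootC P α.1 v = 0) {γ : Module.Dual ℂ (ℂ ⊗[ℝ] V₀)}
    (hγ : γ ∈ weights S k J U) (u : U) : (fJ S k J v - algebraMap ℂ _ (γ v)) • u = 0 := by
  set z := fJ S k J v - algebraMap ℂ _ (γ v) with hz
  have hc : ∀ a, z * a = a * z := sub_algebraMap_comm (fJ_mul_comm hv) _
  obtain ⟨x, hx0, hx⟩ := hγ
  obtain ⟨r, -, hr⟩ := hx v
  rw [← hz] at hr
  rcases eq_bot_or_eq_top (LinearMap.ker (centralEnd hc U)) with h | h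
  · refine absurd ?_ hx0
    have hinj : ∀ y : U, z • y = 0 → y = 0 := LinearMap.ker_eq_bot'.1 h
    clear hx
    induction r with
    | zero => rwa [pow_zero, one_smul] at hr
    | succ r ih => exact ih (hinj _ (by rwa [← mul_smul, ← pow_succ']))
  · have : u ∈ LinearMap.ker (centralEnd hc U) := by rw [h]; trivial
    exact this

variable {U : Type u} [AddCommGroup U] [Module ℂ U] [Module (parabolic S k J) U]
  [IsScalarTower ℂ (parabolic S k J) U]

/-- An eigenvalue of `f_v` is the value at `v` of a weight. -/
theorem exists_mem_weights [Module.Finite ℂ U] {v : ℂ ⊗[ℝ] V₀} {c : ℂ} {u : U} (hu : u ≠ 0)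
    (h : fJ S k J v • u = c • u) : ∃ γ ∈ weights S k J U, γ v = c := by
  let φ : ℂ ⊗[ℝ] V₀ → Module.End ℂ U := fun v => Algebra.lsmul ℂ ℂ U (fJ S k J v)
  have hφ : ∀ v u, φ v u = fJ S k J v • u := fun _ _ => rfl
  have hcomm : ∀ a b u, φ a (φ b u) = φ b (φ a u) := fun a b u => by
    rw [hφ, hφ, hφ, hφ, ← mul_smul, fJ_comm, mul_smul]
  let W₀ : Submodule ℂ U := LinearMap.ker (φ v - c • LinearMap.id)
  have hmem : ∀ y, y ∈ W₀ ↔ φ v y = c • y := fun y => by simp [W₀, sub_eq_zero]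
  obtain ⟨x, hx, hx0, hxe⟩ := exists_common_eigenvector φ hcomm W₀
    (W₀.ne_bot_iff.2 ⟨u, (hmem u).2 h, hu⟩) fun a y hy => by
      rw [hmem] at hy ⊢
      rw [hcomm, hy, map_smul]
  choose g hg using hxe
  have hinj : ∀ {a b : ℂ}, a • x = b • x → a = b := fun h => smul_left_injective ℂ hx0 h
  let γ : Module.Dual ℂ (ℂ ⊗[ℝ] V₀) :=
    { toFun := g
      map_add' := fun a b => hinj (by
        rw [← hg, add_smul, ← hg, ← hg, hφ, hφ, hφ, fJ_add, add_smul])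
      map_smul' := fun r a => hinj (by
        rw [← hg, hφ, fJ_smul, RingHom.id_apply, smul_eq_mul, mul_smul, ← hg, hφ, smul_assoc]) }
  refine ⟨γ, ⟨x, hx0, fun a => ⟨1, one_pos, ?_⟩⟩, hinj ?_⟩
  · rw [pow_one, sub_smul, algebraMap_smul, sub_eq_zero]
    exact hg a
  · exact (hg v).symm.trans ((hmem x).1 hx)

theorem exists_weight [Module.Finite ℂ U] [Nontrivial U] : (weights S k J U).Nonempty := by
  obtain ⟨u, hu⟩ := exists_ne (0 : U)
  obtain ⟨γ, hγ, -⟩ := exists_mem_weights (S := S) (k := k) (J := J) (v := 0) (c := 0) hu (by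
    rw [← zero_smul ℂ (0 : ℂ ⊗[ℝ] V₀), fJ_smul, zero_smul, zero_smul, zero_smul])
  exact ⟨γ, hγ⟩

variable [P.IsRootSystem]

theorem IsTemperedForm.apply_root {x ν : Module.Dual ℝ V₀} (h : IsTemperedForm J x ν) :
    (∀ β ∈ J, ν (P.root β.1) = 0) ∧ ∀ β : S.Idx, 0 ≤ ν (P.root β.1) := by
  classical
  obtain ⟨a, b, -, hb, rfl, -⟩ := h
  have key : ∀ β : S.Idx, (∑ α ∈ Jᶜ, b α • S.fundCoweight α) (P.root β.1) =
      if β ∈ Jᶜ then b β else 0 := fun β => by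
    simp [LinearMap.sum_apply, S.fundCoweight_root]
  refine ⟨fun β hβ => by rw [key, if_neg (by simpa using hβ)], fun β => ?_⟩
  rw [key]
  split_ifs with hβ
  · exact (hb β (by simpa using hβ)).le
  · exact le_rfl

theorem IsTemperedForm.apply_eq {x ν : Module.Dual ℝ V₀} (h : IsTemperedForm J x ν) {y : V₀}
    (hy : ∀ α ∈ J, P.coroot' α.1 y = 0) : x y = ν y := by
  obtain ⟨a, b, -, -, -, rfl⟩ := h
  rw [LinearMap.add_apply, LinearMap.sum_apply, Finset.sum_eq_zero, zero_add]
  intro α hα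
  rw [LinearMap.smul_apply, hy α hα, smul_zero]

theorem IsTemperedForm.apply_le {x ν : Module.Dual ℝ V₀} (h : IsTemperedForm J x ν) {y : V₀}
    (hy : ∀ α ∈ J, 0 ≤ P.coroot' α.1 y) : x y ≤ ν y := by
  obtain ⟨a, b, ha, -, -, rfl⟩ := h
  rw [LinearMap.add_apply, LinearMap.sum_apply]
  refine add_le_of_nonpos_left (Finset.sum_nonpos fun α hα => ?_)
  exact mul_nonpos_of_nonpos_of_nonneg (ha α hα) (hy α hα)

theorem IsLanglandsDatum.nu_spec (h : IsLanglandsDatum S k J U) :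
    ∃ γ ∈ weights S k J U, IsTemperedForm J (rePart γ) (nu S k J U) := by
  have := h.finite
  have := h.irreducible
  have := IsSimpleModule.nontrivial (parabolic S k J) U
  obtain ⟨γ, hγ⟩ := exists_weight (S := S) (k := k) (J := J) (U := U)
  obtain ⟨ν, hν⟩ := h.tempered γ hγ
  exact Classical.epsilon_spec (p := fun ν => ∃ γ ∈ weights S k J U, IsTemperedForm J (rePart γ) ν)
    ⟨ν, γ, hγ, hν⟩

variable [Finite ι]

theorem coroot'_fundWeight_of_notMem {δ : S.Idx} (hδ : δ ∉ J) (α : S.Idx) (hα : α ∈ J) :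
    P.coroot' α.1 (S.fundWeight δ) = 0 := by
  rw [S.coroot'_fundWeight, if_neg]
  rintro rfl
  exact hδ hα

theorem corootC_fundWeight_of_notMem {δ : S.Idx} (hδ : δ ∉ J) (α : S.Idx) (hα : α ∈ J) :
    corootC P α.1 ((1 : ℂ) ⊗ₜ[ℝ] S.fundWeight δ) = 0 := by
  rw [corootC_one_tmul, coroot'_fundWeight_of_notMem hδ α hα]
  simp

/-- The `ν`-part is the same for all weights. -/
theorem IsLanglandsDatum.isTemperedForm_nu (h : IsLanglandsDatum S k J U)
    {γ : Module.Dual ℂ (ℂ ⊗[ℝ] V₀)} (hγ : γ ∈ weights S k J U) :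
    IsTemperedForm J (rePart γ) (nu S k J U) := by
  obtain ⟨γ', hγ', hν'⟩ := h.nu_spec
  obtain ⟨ν, hν⟩ := h.tempered γ hγ
  have := h.irreducible
  have := IsSimpleModule.nontrivial (parabolic S k J) U
  obtain ⟨u, hu⟩ := exists_ne (0 : U)
  suffices ν = nu S k J U by rwa [← this]
  refine S.dual_eq_of_eqOn (J := J) (fun β hβ => ?_) fun δ hδ => ?_
  · rw [hν.apply_root.1 β hβ, hν'.apply_root.1 β hβ]
  · rw [← hν.apply_eq (coroot'_fundWeight_of_notMem hδ),
      ← hν'.apply_eq (coroot'_fundWeight_of_notMem hδ)]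
    have h1 := sub_smul_eq_zero h.irreducible (corootC_fundWeight_of_notMem hδ) hγ u
    have h2 := sub_smul_eq_zero h.irreducible (corootC_fundWeight_of_notMem hδ) hγ' u
    rw [sub_smul, algebraMap_smul, sub_eq_zero] at h1 h2
    exact congrArg Complex.re (smul_left_injective ℂ hu (h1.symm.trans h2))

/-! ### The weights of an induced module -/

variable [P.IsReduced]

/-- The real parts of the eigenvalues of `f_x` on the induced module, for `x ∈ V₀` dominant, are at
most `⟨x, ν⟩`. -/
theorem IsLanglandsDatum.sub_smul_surjective (h : IsLanglandsDatum S k J U) {x : V₀}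
    (hx : S.IsDominant x) {c : ℂ} (hc : nu S k J U x < c.re) :
    Function.Surjective fun y : Induced S k J U =>
      (f S k ((1 : ℂ) ⊗ₜ[ℝ] x) - algebraMap ℂ _ c) • y := by
  have := h.finite
  set v : ℂ ⊗[ℝ] V₀ := (1 : ℂ) ⊗ₜ[ℝ] x with hv
  let T : Module.End ℂ (Induced S k J U) :=
    Algebra.lsmul ℂ ℂ (Induced S k J U) (f S k v - algebraMap ℂ _ c)
  change Function.Surjective T
  rw [← LinearMap.range_eq_top, eq_top_iff]
  suffices key : ∀ (l : List S.Idx) (u : U),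
      Induced.mk (t S k (S.wordProd l)) u ∈ LinearMap.range T by
    intro y _
    induction y using Induced.t_induction with
    | zero => exact zero_mem _
    | mk w u =>
      obtain ⟨l, rfl⟩ := S.exists_wordProd w
      exact key l u
    | add y y' hy hy' => exact add_mem (hy trivial) (hy' trivial)
  intro l
  induction hn : l.length using Nat.strong_induction_on generalizing l with
  | _ n ih =>
    intro u
    by_cases hpos : ∀ α ∈ J, S.IsNonneg (S.wordProd l • P.root α.1)
    · -- The word represents a minimal element of its coset of `W_J`.
      set v' := weylAct (S.wordProd l)⁻¹ v with hv'
      let E : Module.End ℂ U := Algebra.lsmul ℂ ℂ U (fJ S k J v' - algebraMap ℂ _ c)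
      have hE : ∀ u, E u = fJ S k J v' • u - c • u := fun u => by
        rw [← algebraMap_smul (parabolic S k J) c u, ← sub_smul]; rfl
      have hinj : Function.Injective E := by
        rw [← LinearMap.ker_eq_bot, LinearMap.ker_eq_bot']
        intro u hu
        by_contra hu0
        rw [hE, sub_eq_zero] at hu
        obtain ⟨γ, hγ, hγc⟩ := exists_mem_weights hu0 hu
        have h1 : rePart γ ((S.wordProd l)⁻¹ • x) = c.re := by rw [← hγc]; rfl
        have h2 := (h.isTemperedForm_nu hγ).apply_le (y := (S.wordProd l)⁻¹ • x) fun α hα => by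
          have h3 := hpos α hα
          rw [P.weylGroup_apply_root] at h3
          rw [← coroot'_smul (P.weylGroup_apply_root (S.wordProd l) α.1), smul_inv_smul]
          exact hx.coroot'_nonneg h3
        have h4 := S.apply_wordProd_inv_smul_le hx (h.isTemperedForm_nu hγ).apply_root.2 l
        linarith
      obtain ⟨u, rfl⟩ := LinearMap.surjective_of_injective hinj u
      have hlow := f_mul_t_wordProd (k := k) l v
      rw [← hv'] at hlow
      set d := f S k v * t S k (S.wordProd l) - t S k (S.wordProd l) * f S k v' with hd
      have hdm : (Induced.mk d u : Induced S k J U) ∈ LinearMap.range T := by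
        clear_value d
        clear hd
        induction hlow using Submodule.span_induction with
        | mem d hd =>
          obtain ⟨l', hl', rfl⟩ := hd
          exact ih _ (hn ▸ hl') l' rfl u
        | zero => rw [Induced.zero_mk]; exact zero_mem _
        | add d d' _ _ hd hd' => rw [Induced.add_mk]; exact add_mem hd hd'
        | smul r d _ hd => rw [Induced.smul_mk]; exact Submodule.smul_mem _ _ hd
      have heq : (Induced.mk (t S k (S.wordProd l)) (E u) : Induced S k J U) =
          T (Induced.mk (t S k (S.wordProd l)) u) - Induced.mk d u := by
        have h1 : t S k (S.wordProd l) * ((fJ S k J v' - algebraMap ℂ _ c : parabolic S k J) :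
            Hecke S k) = (f S k v - algebraMap ℂ _ c) * t S k (S.wordProd l) - d := by
          rw [hd, sub_mul, Algebra.commutes]
          change t S k (S.wordProd l) * (f S k v' - algebraMap ℂ _ c) = _
          rw [mul_sub]
          abel
        change Induced.mk _ ((fJ S k J v' - algebraMap ℂ _ c) • u) = _
        rw [← Induced.mk_mul, h1, eq_sub_iff_add_eq, ← Induced.add_mk, sub_add_cancel,
          ← Induced.hecke_smul_mk]
        rfl
      rw [heq]
      exact sub_mem ⟨_, rfl⟩ hdm
    · push Not at hpos
      obtain ⟨α, hα, hneg⟩ := hpos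
      obtain ⟨l', hl', hw⟩ := S.exists_wordProd_mul_s l hneg
      have h1 : t S k (S.wordProd l) = t S k (S.wordProd l') *
          ((⟨_, Induced.t_mem (s_mem_parabolicSubgroup S hα)⟩ : parabolic S k J) : Hecke S k) := by
        rw [← t_mul, hw, mul_assoc, ofIdx_mul_self, mul_one]
      rw [h1, Induced.mk_mul]
      exact ih _ (by omega) l' rfl _

end Weights

end GradedHecke

theorem proposition3p5 {ι V₀ N : Type u} [Finite ι]
    [AddCommGroup V₀] [Module ℝ V₀] [AddCommGroup N] [Module ℝ N]
    (P : RootPairing ι ℝ V₀ N) [P.IsRootSystem] [P.IsReduced]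
    (S : GradedHecke.SimpleSystem P)
    (k : S.Idx → ℂ) (hk : GradedHecke.IsParameter S k)
    (J₁ J₂ : Finset S.Idx) (U₁ U₂ : Type u)
    [AddCommGroup U₁] [Module ℂ U₁] [Module (GradedHecke.parabolic S k J₁) U₁]
    [IsScalarTower ℂ (GradedHecke.parabolic S k J₁) U₁]
    [AddCommGroup U₂] [Module ℂ U₂] [Module (GradedHecke.parabolic S k J₂) U₂]
    [IsScalarTower ℂ (GradedHecke.parabolic S k J₂) U₂]
    (h₁ : GradedHecke.IsLanglandsDatum S k J₁ U₁)
    (h₂ : GradedHecke.IsLanglandsDatum S k J₂ U₂)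
    (hν : ¬ S.DomLE (GradedHecke.nu S k J₁ U₁) (GradedHecke.nu S k J₂ U₂))
    (i : ℕ) :
    (∀ M : Submodule (GradedHecke.Hecke S k) (GradedHecke.Induced S k J₂ U₂), IsCoatom M →
      Subsingleton (CategoryTheory.Abelian.Ext
        (ModuleCat.of (GradedHecke.Hecke S k) (GradedHecke.Induced S k J₁ U₁))
        (ModuleCat.of (GradedHecke.Hecke S k) (GradedHecke.Induced S k J₂ U₂ ⧸ M)) i)) ∧
    Subsingleton (CategoryTheory.Abelian.Ext
      (ModuleCat.of (GradedHecke.Hecke S k) (GradedHecke.Induced S k J₁ U₁))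
      (ModuleCat.of (GradedHecke.Hecke S k) (GradedHecke.Induced S k J₂ U₂)) i) := by
  obtain ⟨γ, hγ, hγν⟩ := h₁.nu_spec
  -- A fundamental weight outside `J₁` on which `ν₁` exceeds `ν₂`.
  obtain ⟨γ₂, -, hγ₂⟩ := h₂.nu_spec
  obtain ⟨δ, hδ, hlt⟩ :=
    S.exists_fundWeight_lt hγν.apply_root.1 hγ₂.apply_root.2 hν
  set v : ℂ ⊗[ℝ] V₀ := (1 : ℂ) ⊗ₜ[ℝ] S.fundWeight δ with hv
  have hre : (γ v).re = GradedHecke.nu S k J₁ U₁ (S.fundWeight δ) :=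
    hγν.apply_eq (GradedHecke.coroot'_fundWeight_of_notMem hδ)
  have hvJ := GradedHecke.corootC_fundWeight_of_notMem (P := P) (J := J₁) hδ
  have hz := GradedHecke.sub_algebraMap_comm (GradedHecke.fJ_mul_comm (k := k) hvJ) (γ v)
  have hU := GradedHecke.sub_smul_eq_zero h₁.irreducible hvJ hγ
  have hsurj := h₂.sub_smul_surjective (S.isDominant_fundWeight δ) (c := γ v) (by rwa [hre])
  have := h₂.finite
  have hfin := GradedHecke.Induced.finite (S := S) (k := k) (J := J₂) (U := U₂)
  -- On finite-dimensional modules surjectivity suffices.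
  have hbij : ∀ (X : Type u) [AddCommGroup X] [Module ℂ X] [Module (GradedHecke.Hecke S k) X]
      [IsScalarTower ℂ (GradedHecke.Hecke S k) X] [Module.Finite ℂ X] (z : GradedHecke.Hecke S k),
      Function.Surjective (fun x : X => z • x) → Function.Bijective fun x : X => z • x := by
    intro X _ _ _ _ _ z h
    exact ⟨LinearMap.injective_iff_surjective (f := Algebra.lsmul ℂ ℂ X z).2 h, h⟩
  refine ⟨fun M _ => ?_, ?_⟩
  · refine GradedHecke.subsingleton_ext hk hz (hbij _ _ ?_) hU i
    intro y
    obtain ⟨x, rfl⟩ := M.mkQ_surjective y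
    obtain ⟨x', rfl⟩ := hsurj x
    exact ⟨M.mkQ x', (map_smul M.mkQ _ _).symm⟩
  · exact GradedHecke.subsingleton_ext hk hz (hbij _ _ hsurj) hU i
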